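/- Let $\mathbb{F}$ be $\mathbb{R}$ or $\mathbb{C}$, let $0<p<\infty$, and let $w=(w_j)_{j=1}^\infty$ be a non-increasing sequence of positive numbers with $w_1=1$, $\lim_j w_j=0$ and $\sum_{j=1}^\infty w_j=\infty$. The Garling sequence space $g(w,p)$ is the quasi-Banach space of all sequences $x=(a_j)_{j=1}^\infty$ in $\mathbb{F}$ such that $$\|x\|_{g}=\sup_{\phi}\Bigl(\sum_{j=1}^\infty |a_{\phi(j)}|^p\, w_j\Bigr)^{1/p}<\infty,$$ where the supremum is over all (strictly) increasing maps $\phi\colon\mathbb{N}\to\mathbb{N}$, equipped with the quasi-norm $\|\cdot\|_g$. A sequence $(x_j)_{j=1}^\infty$ in a quasi-Banach space is a basic sequence if every vector $v$ of its closed linear span $[x_j : j\in\mathbb{N}]$ has a unique expansion $v=\sum_{j=1}^\infty a_j x_j$ with scalars $a_j$. Two basic sequences $(x_j)$ and $(y_j)$ are equivalent if, for every scalar sequence $(a_j)$, the series $\sum_j a_jx_j$ converges if and only if $\sum_j a_jy_j$ converges. The basic sequence $(x_j)$ dominates $(y_j)$ if there is a bounded linear operator $T\colon[x_j : j\in\mathbb{N}]\to[y_j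 : j\in\mathbb{N}]$ with $T(x_j)=y_j$ for all $j$. A basic sequence $(x_j)$ is subsymmetric if $(x_{\pi(j)})_{j}$ is a basic sequence for every permutation $\pi$ of $\mathbb{N}$ and $(x_{\phi(j)})_{j}$ is equivalent to $(x_j)_j$ for every increasing map $\phi\colon\mathbb{N}\to\mathbb{N}$. **Theorem.** (i) There is a set $S$ of subsymmetric basic sequences of $g(w,p)$, of the cardinality of the continuum, such that any two distinct members of $S$ are not equivalent and, for any two members of $S$, one of them dominates the other. (ii) There is a set $S'$ of subsymmetric basic sequences of $g(w,p)$, of the cardinality of the continuum, such that for any two distinct members of $S'$ neither of them dominates the other. -/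

import Mathlib

open Filter Topology
open scoped ENNReal Pointwise

noncomputable section

/-! ### Basic sequences in topological vector spaces -/

section BasicSequences

/-- The closed linear span `[x_k : k ∈ ℕ]` of a sequence. -/
def closedSpan (𝕜 : Type*) {E : Type*} [RCLike 𝕜] [AddCommGroup E] [Module 𝕜 E]
    [TopologicalSpace E] [IsTopologicalAddGroup E] [ContinuousSMul 𝕜 E] (x : ℕ → E) :
    Submodule 𝕜 E :=
  (Submodule.span 𝕜 (Set.range x)).topologicalClosure

theorem mem_closedSpan (𝕜 : Type*) {E : Type*} [RCLike 𝕜] [AddCommGroup E] [Module 𝕜 E]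
    [TopologicalSpace E] [IsTopologicalAddGroup E] [ContinuousSMul 𝕜 E] (x : ℕ → E) (n : ℕ) :
    x n ∈ closedSpan 𝕜 x :=
  Submodule.le_topologicalClosure _ (Submodule.subset_span (Set.mem_range_self n))

/-- The series `∑ aⱼ xⱼ` converges to `v`, in the sense of its partial sums. -/
def SeriesTendsto {𝕜 E : Type*} [RCLike 𝕜] [AddCommGroup E] [Module 𝕜 E] [TopologicalSpace E]
    (a : ℕ → 𝕜) (x : ℕ → E) (v : E) : Prop :=
  Tendsto (fun n => ∑ j ∈ Finset.range n, a j • x j) atTop (𝓝 v)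

/-- `x` is a basic sequence: a Schauder basis of its closed linear span. -/
def IsBasicSequence (𝕜 : Type*) {E : Type*} [RCLike 𝕜] [AddCommGroup E] [Module 𝕜 E]
    [TopologicalSpace E] [IsTopologicalAddGroup E] [ContinuousSMul 𝕜 E] (x : ℕ → E) : Prop :=
  ∀ v ∈ closedSpan 𝕜 x, ∃! a : ℕ → 𝕜, SeriesTendsto a x v

/-- `x` and `y` are equivalent: `∑ aⱼ xⱼ` converges if and only if `∑ aⱼ yⱼ` does. -/
def EquivalentSequences (𝕜 : Type*) {E F : Type*} [RCLike 𝕜]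
    [AddCommGroup E] [Module 𝕜 E] [TopologicalSpace E]
    [AddCommGroup F] [Module 𝕜 F] [TopologicalSpace F] (x : ℕ → E) (y : ℕ → F) : Prop :=
  ∀ a : ℕ → 𝕜, (∃ v, SeriesTendsto a x v) ↔ ∃ v, SeriesTendsto a y v

/-- `x` dominates `y`: there is a bounded (that is, continuous) linear operator
`T : [x_k] → [y_k]` with `T x_n = y_n` for all `n`. -/
def Dominates (𝕜 : Type*) {E F : Type*} [RCLike 𝕜]
    [AddCommGroup E] [Module 𝕜 E] [TopologicalSpace E] [IsTopologicalAddGroup E]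
    [ContinuousSMul 𝕜 E]
    [AddCommGroup F] [Module 𝕜 F] [TopologicalSpace F] [IsTopologicalAddGroup F]
    [ContinuousSMul 𝕜 F] (x : ℕ → E) (y : ℕ → F) : Prop :=
  ∃ T : closedSpan 𝕜 x →L[𝕜] closedSpan 𝕜 y,
    ∀ n, T ⟨x n, mem_closedSpan 𝕜 x n⟩ = ⟨y n, mem_closedSpan 𝕜 y n⟩

/-- A basic sequence is unconditional if each of its rearrangements is a basic sequence. -/
def IsUnconditionalBasicSequence (𝕜 : Type*) {E : Type*} [RCLike 𝕜] [AddCommGroup E]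
    [Module 𝕜 E] [TopologicalSpace E] [IsTopologicalAddGroup E] [ContinuousSMul 𝕜 E]
    (x : ℕ → E) : Prop :=
  IsBasicSequence 𝕜 x ∧ ∀ π : Equiv.Perm ℕ, IsBasicSequence 𝕜 (x ∘ π)

/-- A basic sequence is subsymmetric if it is unconditional and equivalent to each of its
subsequences. -/
def IsSubsymmetric (𝕜 : Type*) {E : Type*} [RCLike 𝕜] [AddCommGroup E]
    [Module 𝕜 E] [TopologicalSpace E] [IsTopologicalAddGroup E] [ContinuousSMul 𝕜 E]
    (x : ℕ → E) : Prop :=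
  IsUnconditionalBasicSequence 𝕜 x ∧
    ∀ φ : ℕ → ℕ, StrictMono φ → EquivalentSequences 𝕜 (x ∘ φ) x

end BasicSequences

/-! ### Garling sequence spaces -/

/-- The set `𝒲` of weights: non-increasing sequences of positive numbers that start with `1`
(the first index is `0` here), tend to `0` and are not summable. -/
def garlingWeights : Set (ℕ → ℝ) :=
  {w | w 0 = 1 ∧ Antitone w ∧ (∀ j, 0 < w j) ∧ Tendsto w atTop (𝓝 0) ∧ ¬ Summable w}

/-- The Garling quasi-norm `sup_φ (∑ⱼ |a_{φ(j)}|^p wⱼ)^{1/p}` of a scalar sequence, with values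
in `[0, ∞]`; the supremum is over the increasing maps `φ : ℕ → ℕ`. -/
def garlingENorm {𝕜 : Type*} [RCLike 𝕜] (w : ℕ → ℝ) (p : ℝ) (a : ℕ → 𝕜) : ℝ≥0∞ :=
  ⨆ (φ : ℕ → ℕ) (_ : StrictMono φ),
    (∑' j, ‖a (φ j)‖ₑ ^ p * ENNReal.ofReal (w j)) ^ (1 / p)

section Garling

variable {𝕜 : Type*} [RCLike 𝕜] {w : ℕ → ℝ} {p : ℝ}

theorem garlingENorm_zero (hp : 0 < p) : garlingENorm w p (0 : ℕ → 𝕜) = 0 := by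
  simp [garlingENorm, ENNReal.zero_rpow_of_pos hp, hp]

theorem garlingENorm_smul (hp : 0 < p) (c : 𝕜) (a : ℕ → 𝕜) :
    garlingENorm w p (c • a) = ‖c‖ₑ * garlingENorm w p a := by
  simp only [garlingENorm, ENNReal.mul_iSup]
  refine iSup_congr fun φ => iSup_congr fun _ => ?_
  have : ∀ j, ‖(c • a) (φ j)‖ₑ ^ p * ENNReal.ofReal (w j)
      = ‖c‖ₑ ^ p * (‖a (φ j)‖ₑ ^ p * ENNReal.ofReal (w j)) := fun j => by
    rw [Pi.smul_apply, smul_eq_mul, enorm_mul, ENNReal.mul_rpow_of_nonneg _ _ hp.le, mul_assoc]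
  simp_rw [this]
  rw [ENNReal.tsum_mul_left, ENNReal.mul_rpow_of_nonneg _ _ (by positivity), ← ENNReal.rpow_mul,
    mul_one_div_cancel hp.ne', ENNReal.rpow_one]

theorem garlingENorm_add (hp : 0 < p) (a b : ℕ → 𝕜) :
    garlingENorm w p (a + b) ≤
      2 * 2 ^ (1 / p) * max (garlingENorm w p a) (garlingENorm w p b) := by
  refine iSup₂_le fun φ hφ => ?_
  have key : ∀ c : ℕ → 𝕜, ∑' j, ‖c (φ j)‖ₑ ^ p * ENNReal.ofReal (w j)
      ≤ garlingENorm w p c ^ p := fun c => by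
    have h := le_iSup₂ (f := fun (φ : ℕ → ℕ) (_ : StrictMono φ) =>
      (∑' j, ‖c (φ j)‖ₑ ^ p * ENNReal.ofReal (w j)) ^ (1 / p)) φ hφ
    have h' := ENNReal.rpow_le_rpow h hp.le
    rwa [← ENNReal.rpow_mul, one_div_mul_cancel hp.ne', ENNReal.rpow_one] at h'
  have hsum : ∑' j, ‖(a + b) (φ j)‖ₑ ^ p * ENNReal.ofReal (w j)
      ≤ 2 ^ p * (2 * max (garlingENorm w p a) (garlingENorm w p b) ^ p) := by
    have hpt : ∀ j, ‖(a + b) (φ j)‖ₑ ^ p * ENNReal.ofReal (w j)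
        ≤ 2 ^ p * (‖a (φ j)‖ₑ ^ p * ENNReal.ofReal (w j)
          + ‖b (φ j)‖ₑ ^ p * ENNReal.ofReal (w j)) := fun j => by
      rw [← add_mul, ← mul_assoc]
      gcongr
      calc ‖(a + b) (φ j)‖ₑ ^ p ≤ (2 * max ‖a (φ j)‖ₑ ‖b (φ j)‖ₑ) ^ p := by
            refine ENNReal.rpow_le_rpow ((enorm_add_le _ _).trans ?_) hp.le
            rw [two_mul]
            exact add_le_add (le_max_left _ _) (le_max_right _ _)
        _ = 2 ^ p * max ‖a (φ j)‖ₑ ‖b (φ j)‖ₑ ^ p := ENNReal.mul_rpow_of_nonneg _ _ hp.le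
        _ ≤ _ := by
            gcongr
            rcases le_total ‖a (φ j)‖ₑ ‖b (φ j)‖ₑ with h | h
            · rw [max_eq_right h]; exact le_add_self
            · rw [max_eq_left h]; exact le_self_add
    refine (ENNReal.tsum_le_tsum hpt).trans ?_
    rw [ENNReal.tsum_mul_left, ENNReal.tsum_add, two_mul]
    gcongr
    · exact (key a).trans (ENNReal.rpow_le_rpow (le_max_left _ _) hp.le)
    · exact (key b).trans (ENNReal.rpow_le_rpow (le_max_right _ _) hp.le)
  refine (ENNReal.rpow_le_rpow hsum (by positivity : 0 ≤ 1 / p)).trans (le_of_eq ?_)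
  rw [ENNReal.mul_rpow_of_nonneg _ _ (by positivity), ENNReal.mul_rpow_of_nonneg _ _ (by positivity),
    ← ENNReal.rpow_mul, ← ENNReal.rpow_mul, mul_one_div_cancel hp.ne', ENNReal.rpow_one,
    ENNReal.rpow_one, mul_assoc]

variable (𝕜 w p)

/-- The scalar sequences with finite Garling quasi-norm. -/
def garlingSubmodule (hp : 0 < p) : Submodule 𝕜 (ℕ → 𝕜) where
  carrier := {a | garlingENorm w p a < ∞}
  zero_mem' := by simp [garlingENorm_zero hp]
  add_mem' {a b} ha hb :=
    (garlingENorm_add hp a b).trans_lt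
      (ENNReal.mul_lt_top (ENNReal.mul_lt_top ENNReal.ofNat_lt_top
        (ENNReal.rpow_lt_top_of_nonneg (by positivity) ENNReal.ofNat_ne_top)) (max_lt ha hb))
  smul_mem' c a ha :=
    (garlingENorm_smul hp c a).trans_lt (ENNReal.mul_lt_top enorm_lt_top ha)

/-- The Garling sequence space `g(w, p)`. (A type of its own, so that it does not inherit the
topology of pointwise convergence.) -/
def GarlingSpace (hp : 0 < p) : Type _ := garlingSubmodule 𝕜 w p hp

variable {𝕜 w p}

namespace GarlingSpace

instance (hp : 0 < p) : AddCommGroup (GarlingSpace 𝕜 w p hp) :=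
  inferInstanceAs (AddCommGroup (garlingSubmodule 𝕜 w p hp))

instance (hp : 0 < p) : Module 𝕜 (GarlingSpace 𝕜 w p hp) :=
  inferInstanceAs (Module 𝕜 (garlingSubmodule 𝕜 w p hp))

/-- The sequence of scalars that an element of `g(w, p)` is. -/
def toSeq {hp : 0 < p} (x : GarlingSpace 𝕜 w p hp) : ℕ → 𝕜 :=
  (show garlingSubmodule 𝕜 w p hp from x).1

/-- The quasi-norm of `g(w, p)`. -/
instance (hp : 0 < p) : Norm (GarlingSpace 𝕜 w p hp) :=
  ⟨fun x => (garlingENorm w p x.toSeq).toReal⟩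

theorem norm_def {hp : 0 < p} (x : GarlingSpace 𝕜 w p hp) :
    ‖x‖ = (garlingENorm w p x.toSeq).toReal := rfl

theorem garlingENorm_toSeq_ne_top {hp : 0 < p} (x : GarlingSpace 𝕜 w p hp) :
    garlingENorm w p x.toSeq ≠ ∞ :=
  ne_of_lt (show garlingSubmodule 𝕜 w p hp from x).2

theorem quasinorm_nonneg {hp : 0 < p} (x : GarlingSpace 𝕜 w p hp) : 0 ≤ ‖x‖ :=
  ENNReal.toReal_nonneg

theorem quasinorm_zero {hp : 0 < p} : ‖(0 : GarlingSpace 𝕜 w p hp)‖ = 0 := by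
  rw [norm_def, show (0 : GarlingSpace 𝕜 w p hp).toSeq = 0 from rfl, garlingENorm_zero hp,
    ENNReal.toReal_zero]

theorem quasinorm_smul {hp : 0 < p} (c : 𝕜) (x : GarlingSpace 𝕜 w p hp) :
    ‖c • x‖ = ‖c‖ * ‖x‖ := by
  rw [norm_def, show (c • x).toSeq = c • x.toSeq from rfl, garlingENorm_smul hp,
    ENNReal.toReal_mul, toReal_enorm, norm_def]

theorem quasinorm_add {hp : 0 < p} (x y : GarlingSpace 𝕜 w p hp) :
    ‖x + y‖ ≤ 2 * 2 ^ (1 / p) * max ‖x‖ ‖y‖ := by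
  have h := garlingENorm_add (w := w) hp x.toSeq y.toSeq
  have hx := x.garlingENorm_toSeq_ne_top
  have hy := y.garlingENorm_toSeq_ne_top
  have hm : max (garlingENorm w p x.toSeq) (garlingENorm w p y.toSeq) ≠ ∞ :=
    (max_lt hx.lt_top hy.lt_top).ne
  have h2 : (2 : ℝ≥0∞) ^ (1 / p) ≠ ∞ :=
    (ENNReal.rpow_lt_top_of_nonneg (by positivity) ENNReal.ofNat_ne_top).ne
  have h3 := ENNReal.toReal_mono
    (ENNReal.mul_ne_top (ENNReal.mul_ne_top ENNReal.ofNat_ne_top h2) hm) h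
  rw [ENNReal.toReal_mul, ENNReal.toReal_mul, ENNReal.toReal_max hx hy, ← ENNReal.toReal_rpow] at h3
  rw [ENNReal.toReal_ofNat] at h3
  exact h3

/-- The balls of the quasi-norm around `0`, as a basis of neighbourhoods of `0`. -/
def ballBasis (hp : 0 < p) : ModuleFilterBasis 𝕜 (GarlingSpace 𝕜 w p hp) where
  sets := {U | ∃ ε : ℝ, 0 < ε ∧ U = {x | ‖x‖ < ε}}
  nonempty := ⟨_, 1, one_pos, rfl⟩
  inter_sets := by
    rintro _ _ ⟨ε, hε, rfl⟩ ⟨δ, hδ, rfl⟩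
    exact ⟨_, ⟨min ε δ, lt_min hε hδ, rfl⟩, fun x hx =>
      ⟨lt_of_lt_of_le (show ‖x‖ < min ε δ from hx) (min_le_left _ _),
        lt_of_lt_of_le (show ‖x‖ < min ε δ from hx) (min_le_right _ _)⟩⟩
  zero' := by
    rintro _ ⟨ε, hε, rfl⟩
    simpa [quasinorm_zero] using hε
  add' := by
    rintro _ ⟨ε, hε, rfl⟩
    have hK : (0 : ℝ) < 2 * 2 ^ (1 / p) := by positivity
    refine ⟨_, ⟨ε / (2 * 2 ^ (1 / p)), div_pos hε hK, rfl⟩, ?_⟩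
    rintro _ ⟨x, hx, y, hy, rfl⟩
    exact (quasinorm_add x y).trans_lt ((lt_div_iff₀' hK).1 (max_lt hx hy))
  neg' := by
    rintro _ ⟨ε, hε, rfl⟩
    refine ⟨_, ⟨ε, hε, rfl⟩, fun x hx => ?_⟩
    have := quasinorm_smul (-1 : 𝕜) x
    simp only [neg_smul, one_smul, norm_neg, norm_one, one_mul] at this
    simpa [this] using hx
  conj' := by
    rintro x₀ _ ⟨ε, hε, rfl⟩
    exact ⟨_, ⟨ε, hε, rfl⟩, fun x hx => by simpa using hx⟩
  smul' := by
    rintro _ ⟨ε, hε, rfl⟩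
    refine ⟨Metric.ball 0 1, Metric.ball_mem_nhds _ one_pos, _, ⟨ε, hε, rfl⟩, ?_⟩
    rintro _ ⟨c, hc, x, hx, rfl⟩
    have hc' : ‖c‖ ≤ 1 := (mem_ball_zero_iff.1 hc).le
    refine lt_of_le_of_lt ?_ (show ‖x‖ < ε from hx)
    rw [quasinorm_smul]
    exact mul_le_of_le_one_left (quasinorm_nonneg x) hc'
  smul_left' := by
    rintro c _ ⟨ε, hε, rfl⟩
    have hc : 0 < ‖c‖ + 1 := by positivity
    refine ⟨_, ⟨ε / (‖c‖ + 1), div_pos hε hc, rfl⟩, fun x hx => ?_⟩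
    have h1 : (‖c‖ + 1) * ‖x‖ < ε := (lt_div_iff₀' hc).1 hx
    have h2 := quasinorm_smul c x
    have h3 := quasinorm_nonneg x
    show ‖c • x‖ < ε
    nlinarith
  smul_right' := by
    rintro x _ ⟨ε, hε, rfl⟩
    have h : Tendsto (fun c : 𝕜 => ‖c‖ * ‖x‖) (𝓝 0) (𝓝 (‖(0 : 𝕜)‖ * ‖x‖)) :=
      (continuous_norm.tendsto 0).mul_const _
    rw [norm_zero, zero_mul] at h
    filter_upwards [h.eventually (gt_mem_nhds hε)] with c hc
    simpa [quasinorm_smul] using hc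

/-- The topology of `g(w, p)`, given by its quasi-norm. -/
instance (hp : 0 < p) : TopologicalSpace (GarlingSpace 𝕜 w p hp) :=
  (ballBasis (𝕜 := 𝕜) (w := w) hp).topology

instance (hp : 0 < p) : IsTopologicalAddGroup (GarlingSpace 𝕜 w p hp) :=
  (ballBasis (𝕜 := 𝕜) (w := w) hp).toAddGroupFilterBasis.isTopologicalAddGroup

instance (hp : 0 < p) : ContinuousSMul 𝕜 (GarlingSpace 𝕜 w p hp) :=
  (ballBasis (𝕜 := 𝕜) (w := w) hp).continuousSMul

end GarlingSpace

end Garling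

end

/-! The `p`-th power of the quasi-norm of `x` is `spreadNorm v c` with `c i = |x i|^p` and `v` the
weight. This functional is monotone, countably subadditive, and unaffected by moving the nonzero
entries without changing their order.

Fix `d` of finite functional with `d 0 = 1`, cut it off at lengths `B n` and put the pieces on
consecutive intervals. If the part of `d` beyond `B n` has functional at most `2⁻¹ ^ (n + 1)`, then
the `p`-th power of the norm of `∑ aₙ xₙ` agrees up to a factor 2 with `tensorNorm v d (|aₙ|^p)`, in
which full copies of `d` scaled by `|aₙ|^p` follow one another. The same estimate holds for every
subsequence with the same right-hand side, so the sequence is subsymmetric; unconditionality comes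
from the disjoint supports.

Many different `d` come from counting copies. `N` copies of a fixed summable `u` have functional at
most `(∑ u) (v 0 + … + v (N - 1)) = o(N)`, since `v` tends to 0 (`tensorNorm_indicator_le`). But
since `∑ v = ∞`, every `N` admits a finite `u` of functional at most 2 whose `N` copies have
functional at least `N - 1` (`exists_copies`). Choosing numbers `N m` and vectors `u (m + 1)`
alternately, and adding the `u m` with rapidly decreasing factors, gives a sequence `c` in which `N
m` copies detect whether the piece `u (m + 1)` is present (`exists_profile`).

Keeping only the pieces indexed by `A ⊆ ℕ` gives a sequence `X A`. If `A ⊆ B`, multiplication by an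
indicator function shows that `X B` dominates `X A`. If `A \ B` is infinite, the corresponding tests
superposed give coefficients whose series converges for `X B` and diverges for `X A`
(`exists_separating`). Dedekind cuts of `ℚ` then supply the chain, and cuts paired with their
opposites the antichain. -/

/-! ### Weighted sums over finite subsets of a linear order -/

section SpreadNorm

/-- The number of elements of `s` below `i`. -/
def rankIn {ι : Type*} [LinearOrder ι] (s : Finset ι) (i : ι) : ℕ := (s.filter (· < i)).card

/-- The supremum of the sums `∑ cᵢ vₖ` over the finite sets `s` of indices, `k` being the position
of `i` in `s`. -/
noncomputable def spreadNorm {ι : Type*} [LinearOrder ι] (v : ℕ → ℝ≥0∞) (c : ι → ℝ≥0∞) : ℝ≥0∞ :=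
  ⨆ s : Finset ι, ∑ i ∈ s, c i * v (rankIn s i)

variable {ι κ : Type*} [LinearOrder ι] [LinearOrder κ] {v : ℕ → ℝ≥0∞}

theorem rankIn_mono {s t : Finset ι} (h : s ⊆ t) (i : ι) : rankIn s i ≤ rankIn t i :=
  Finset.card_le_card (Finset.filter_subset_filter _ h)

theorem sum_le_spreadNorm (c : ι → ℝ≥0∞) (s : Finset ι) :
    ∑ i ∈ s, c i * v (rankIn s i) ≤ spreadNorm v c :=
  le_iSup (fun s : Finset ι => ∑ i ∈ s, c i * v (rankIn s i)) s

theorem spreadNorm_mono {c d : ι → ℝ≥0∞} (h : ∀ i, c i ≤ d i) :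
    spreadNorm v c ≤ spreadNorm v d :=
  iSup_mono fun _ => Finset.sum_le_sum fun i _ => mul_le_mul_left (h i) _

/-- Lower semicontinuity. -/
theorem spreadNorm_le_of_finset {c : ι → ℝ≥0∞} {M : ℝ≥0∞}
    (h : ∀ s : Finset ι, ∃ d : ι → ℝ≥0∞, (∀ i ∈ s, c i ≤ d i) ∧ spreadNorm v d ≤ M) :
    spreadNorm v c ≤ M := by
  refine iSup_le fun s => ?_
  obtain ⟨d, hd, hM⟩ := h s
  exact (Finset.sum_le_sum fun i hi => mul_le_mul_left (hd i hi) _).trans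
    ((sum_le_spreadNorm d s).trans hM)

theorem spreadNorm_zero : spreadNorm v (fun _ : ι => 0) = 0 := by
  simp [spreadNorm]

theorem spreadNorm_const_mul (a : ℝ≥0∞) (c : ι → ℝ≥0∞) :
    spreadNorm v (fun i => a * c i) = a * spreadNorm v c := by
  simp only [spreadNorm, ENNReal.mul_iSup, Finset.mul_sum, mul_assoc]

/-- Each finite set gives a functional linear in `c`, and a supremum of such functionals is
countably subadditive. -/
theorem spreadNorm_tsum_le {α : Type*} (f : α → ι → ℝ≥0∞) :
    spreadNorm v (fun i => ∑' k, f k i) ≤ ∑' k, spreadNorm v (f k) := by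
  refine iSup_le fun s => ?_
  simp only [← ENNReal.tsum_mul_right]
  rw [← Summable.tsum_finsetSum fun _ _ => ENNReal.summable]
  exact ENNReal.tsum_le_tsum fun k => sum_le_spreadNorm (f k) s

theorem spreadNorm_add_le (c d : ι → ℝ≥0∞) :
    spreadNorm v (fun i => c i + d i) ≤ spreadNorm v c + spreadNorm v d := by
  refine iSup_le fun s => ?_
  simp only [add_mul, Finset.sum_add_distrib]
  exact add_le_add (sum_le_spreadNorm c s) (sum_le_spreadNorm d s)

theorem le_spreadNorm (hv0 : v 0 = 1) (c : ι → ℝ≥0∞) (i : ι) : c i ≤ spreadNorm v c := by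
  have h := sum_le_spreadNorm (v := v) c {i}
  have h0 : rankIn {i} i = 0 := by simp [rankIn]
  simpa [h0, hv0] using h

/-- The sums do not decrease when the nonzero entries are moved to other places without changing
their order. -/
theorem spreadNorm_le_of_rel [Nonempty κ] (hv : Antitone v) {c : ι → ℝ≥0∞} {d : κ → ℝ≥0∞}
    (r : ι → κ → Prop) (h1 : ∀ i, c i ≠ 0 → ∃ k, r i k ∧ c i ≤ d k)
    (h2 : ∀ i i' k k', r i k → r i' k' → i < i' → k < k') :
    spreadNorm v c ≤ spreadNorm v d := by
  classical
  choose! f hf hcd using h1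
  refine iSup_le fun s => ?_
  set s' := s.filter (fun i => c i ≠ 0) with hs'
  have hmem : ∀ i ∈ s', c i ≠ 0 := fun i hi => (Finset.mem_filter.1 hi).2
  have hmono : ∀ i ∈ s', ∀ j ∈ s', i < j → f i < f j := fun i hi j hj hij =>
    h2 _ _ _ _ (hf i (hmem i hi)) (hf j (hmem j hj)) hij
  have hinj : Set.InjOn f s' := fun i hi j hj hij => by
    rcases lt_trichotomy i j with h | h | h
    · exact absurd hij (hmono i hi j hj h).ne
    · exact h
    · exact absurd hij (hmono j hj i hi h).ne'
  -- Whatever lies before `f i` in the image comes from indices before `i`, so ranks can only drop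
  -- and weights only grow.
  have hrank : ∀ i ∈ s', rankIn (s'.image f) (f i) ≤ rankIn s i := fun i hi => by
    refine (Finset.card_le_card ?_).trans (Finset.card_image_le (f := f))
    intro k hk
    obtain ⟨hk1, hk2⟩ := Finset.mem_filter.1 hk
    obtain ⟨j, hj, rfl⟩ := Finset.mem_image.1 hk1
    refine Finset.mem_image_of_mem _ (Finset.mem_filter.2 ⟨(Finset.mem_filter.1 hj).1, ?_⟩)
    by_contra hij
    rcases (not_lt.1 hij).lt_or_eq with h | h
    · exact lt_asymm hk2 (hmono i hi j hj h)
    · exact hk2.ne (by rw [h])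
  calc ∑ i ∈ s, c i * v (rankIn s i) = ∑ i ∈ s', c i * v (rankIn s i) := by
        rw [hs', Finset.sum_filter]
        refine Finset.sum_congr rfl fun i _ => ?_
        by_cases h : c i = 0 <;> simp [h]
    _ ≤ ∑ i ∈ s', d (f i) * v (rankIn (s'.image f) (f i)) :=
        Finset.sum_le_sum fun i hi => mul_le_mul' (hcd i (hmem i hi)) (hv (hrank i hi))
    _ = ∑ k ∈ s'.image f, d k * v (rankIn (s'.image f) k) := by
        rw [Finset.sum_image hinj]
    _ ≤ spreadNorm v d := sum_le_spreadNorm d _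

theorem sum_rankIn (s : Finset ι) : ∑ i ∈ s, v (rankIn s i) = ∑ j ∈ Finset.range s.card, v j := by
  classical
  induction s using Finset.induction_on_max with
  | empty => simp
  | insert a s ha ih =>
    have hna : a ∉ s := fun h => lt_irrefl _ (ha a h)
    have h1 : rankIn (insert a s) a = s.card := by
      rw [rankIn, Finset.filter_insert, if_neg (lt_irrefl a), Finset.filter_true_of_mem ha]
    have h2 : ∀ i ∈ s, rankIn (insert a s) i = rankIn s i := fun i hi => by
      rw [rankIn, Finset.filter_insert, if_neg (ha i hi).not_gt, rankIn]
    rw [Finset.sum_insert hna, h1, Finset.sum_congr rfl fun i hi => by rw [h2 i hi], ih,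
      Finset.card_insert_of_notMem hna, Finset.sum_range_succ, add_comm]

/-- Discarding the indices outside `F` only lowers ranks, and the remaining ones use the first
weights, each once. -/
theorem spreadNorm_indicator_le (hv : Antitone v) (F : Finset ι) {c : ι → ℝ≥0∞}
    (hc : ∀ i, c i ≤ 1) (hF : ∀ i ∉ F, c i = 0) :
    spreadNorm v c ≤ ∑ j ∈ Finset.range F.card, v j := by
  classical
  refine iSup_le fun s => ?_
  calc ∑ i ∈ s, c i * v (rankIn s i) ≤ ∑ i ∈ s ∩ F, v (rankIn (s ∩ F) i) := by
        rw [← Finset.sum_subset (Finset.inter_subset_left (s₁ := s) (s₂ := F))]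
        · refine Finset.sum_le_sum fun i _ => ?_
          exact (mul_le_of_le_one_left' (hc i)).trans (hv (rankIn_mono Finset.inter_subset_left i))
        · intro i hi hi'
          rw [hF i fun h => hi' (Finset.mem_inter.2 ⟨hi, h⟩), zero_mul]
    _ = ∑ j ∈ Finset.range (s ∩ F).card, v j := sum_rankIn _
    _ ≤ _ := Finset.sum_le_sum_of_subset
        (Finset.range_mono (Finset.card_le_card Finset.inter_subset_right))

/-- Subadditivity with respect to the rows of a double sequence. -/
theorem spreadNorm_lex_le_tsum (hv : Antitone v) (g : ℕ → ℕ → ℝ≥0∞) :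
    spreadNorm v (fun x : ℕ ×ₗ ℕ => g (ofLex x).1 (ofLex x).2) ≤ ∑' n, spreadNorm v (g n) := by
  have h : (fun x : ℕ ×ₗ ℕ => g (ofLex x).1 (ofLex x).2)
      = fun x : ℕ ×ₗ ℕ => ∑' n, if (ofLex x).1 = n then g n (ofLex x).2 else 0 := by
    funext x
    rw [tsum_eq_single (ofLex x).1 fun n hn => if_neg hn.symm, if_pos rfl]
  rw [h]
  refine (spreadNorm_tsum_le _).trans (ENNReal.tsum_le_tsum fun n => ?_)
  refine spreadNorm_le_of_rel hv (fun x t => (ofLex x).1 = n ∧ (ofLex x).2 = t) ?_ ?_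
  · intro x hx
    have hn : (ofLex x).1 = n := by
      by_contra h
      exact hx (if_neg h)
    exact ⟨_, ⟨hn, rfl⟩, by simp [hn]⟩
  · rintro x y t t' ⟨hx, rfl⟩ ⟨hy, rfl⟩ hxy
    rcases Prod.Lex.lt_iff.1 hxy with h | h
    · exact absurd (hx.trans hy.symm) h.ne
    · exact h.2

/-! ### Consecutive scaled copies of one sequence -/

/-- The sums over a double sequence `bₙ uₜ`, ordered lexicographically. -/
noncomputable def tensorNorm (v u b : ℕ → ℝ≥0∞) : ℝ≥0∞ :=
  spreadNorm v (fun x : ℕ ×ₗ ℕ => b (ofLex x).1 * u (ofLex x).2)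

theorem tensorNorm_mono {u u' b b' : ℕ → ℝ≥0∞} (hu : ∀ t, u t ≤ u' t) (hb : ∀ n, b n ≤ b' n) :
    tensorNorm v u b ≤ tensorNorm v u' b' :=
  spreadNorm_mono fun _ => mul_le_mul' (hb _) (hu _)

theorem tensorNorm_le_tsum_mul (hv : Antitone v) (u b : ℕ → ℝ≥0∞) :
    tensorNorm v u b ≤ (∑' n, b n) * spreadNorm v u := by
  refine (spreadNorm_lex_le_tsum hv fun n t => b n * u t).trans (le_of_eq ?_)
  simp only [spreadNorm_const_mul, ENNReal.tsum_mul_right]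

theorem tensorNorm_tsum_right_le {α : Type*} (u : ℕ → ℝ≥0∞) (b : α → ℕ → ℝ≥0∞) :
    tensorNorm v u (fun n => ∑' k, b k n) ≤ ∑' k, tensorNorm v u (b k) := by
  simp only [tensorNorm, ← ENNReal.tsum_mul_right]
  exact spreadNorm_tsum_le _

theorem tensorNorm_tsum_left_le {α : Type*} (u : α → ℕ → ℝ≥0∞) (b : ℕ → ℝ≥0∞) :
    tensorNorm v (fun t => ∑' k, u k t) b ≤ ∑' k, tensorNorm v (u k) b := by
  simp only [tensorNorm, ← ENNReal.tsum_mul_left]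
  exact spreadNorm_tsum_le _

theorem tensorNorm_const_mul_left (a : ℝ≥0∞) (u b : ℕ → ℝ≥0∞) :
    tensorNorm v (fun t => a * u t) b = a * tensorNorm v u b := by
  simp only [tensorNorm, ← spreadNorm_const_mul, mul_left_comm]

theorem tensorNorm_const_mul_right (a : ℝ≥0∞) (u b : ℕ → ℝ≥0∞) :
    tensorNorm v u (fun n => a * b n) = a * tensorNorm v u b := by
  simp only [tensorNorm, ← spreadNorm_const_mul, mul_assoc]

/-- Moving the nonzero entries of both factors to other places without changing their order. -/
theorem tensorNorm_le_of_rel (hv : Antitone v) {u u' b b' : ℕ → ℝ≥0∞} (r q : ℕ → ℕ → Prop)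
    (hu : ∀ t, u t ≠ 0 → ∃ t', r t t' ∧ u t ≤ u' t')
    (hr : ∀ i i' k k', r i k → r i' k' → i < i' → k < k')
    (hb : ∀ n, b n ≠ 0 → ∃ n', q n n' ∧ b n ≤ b' n')
    (hq : ∀ i i' k k', q i k → q i' k' → i < i' → k < k')
    (hq' : ∀ i k k', q i k → q i k' → k = k') :
    tensorNorm v u b ≤ tensorNorm v u' b' := by
  refine spreadNorm_le_of_rel hv
    (fun x y => q (ofLex x).1 (ofLex y).1 ∧ r (ofLex x).2 (ofLex y).2) ?_ ?_
  · intro x hx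
    obtain ⟨t', ht, hut⟩ := hu _ (right_ne_zero_of_mul hx)
    obtain ⟨n', hn, hbn⟩ := hb _ (left_ne_zero_of_mul hx)
    exact ⟨toLex (n', t'), ⟨hn, ht⟩, mul_le_mul' hbn hut⟩
  · rintro x x' y y' ⟨h1, h2⟩ ⟨h3, h4⟩ hlt
    rw [Prod.Lex.lt_iff] at hlt ⊢
    rcases hlt with h | ⟨h, h'⟩
    · exact Or.inl (hq _ _ _ _ h1 h3 h)
    · rw [h] at h1
      exact Or.inr ⟨hq' _ _ _ h1 h3, hr _ _ _ _ h2 h4 h'⟩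

/-- `N` copies of a unit vector are `N` entries equal to 1, and `u` is a sum of multiples of unit
vectors. -/
theorem tensorNorm_indicator_le (hv : Antitone v) (u : ℕ → ℝ≥0∞) (N : ℕ) :
    tensorNorm v u (fun n => if n < N then 1 else 0)
      ≤ (∑' t, u t) * ∑ j ∈ Finset.range N, v j := by
  classical
  have h : u = fun t => ∑' k, u k * if t = k then 1 else 0 := by
    funext t
    rw [tsum_eq_single t fun k hk => by simp [hk.symm]]
    simp
  conv_lhs => rw [h]
  refine (tensorNorm_tsum_left_le _ _).trans ?_
  rw [← ENNReal.tsum_mul_right]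
  refine ENNReal.tsum_le_tsum fun k => ?_
  rw [tensorNorm_const_mul_left]
  gcongr
  have := spreadNorm_indicator_le hv
    (c := fun x : ℕ ×ₗ ℕ => (if (ofLex x).1 < N then 1 else 0) * if (ofLex x).2 = k then 1 else 0)
    ((Finset.range N).image fun n => toLex (n, k)) (fun x => by split_ifs <;> simp) (fun x hx => by
      by_contra hne
      refine hx (Finset.mem_image.2 ⟨(ofLex x).1, ?_, ?_⟩)
      · by_contra h
        exact hne (by simp [Finset.mem_range.not.1 h])
      · have : (ofLex x).2 = k := by
          by_contra h
          exact hne (by simp [h])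
        rw [← this]
        rfl)
  refine this.trans (Finset.sum_le_sum_of_subset (Finset.range_mono ?_))
  exact Finset.card_image_le.trans (by simp)

/-- A countably subadditive monotone functional is small on the tails of a sum of finitely
supported sequences whose values are summable. -/
theorem exists_tail_le {Φ : (ℕ → ℝ≥0∞) → ℝ≥0∞}
    (hmono : ∀ f g : ℕ → ℝ≥0∞, (∀ i, f i ≤ g i) → Φ f ≤ Φ g)
    (hsub : ∀ f : ℕ → ℕ → ℝ≥0∞, Φ (fun i => ∑' m, f m i) ≤ ∑' m, Φ (f m)) (h0 : Φ (fun _ => 0) = 0)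
    (f : ℕ → ℕ → ℝ≥0∞) (hf : ∀ m, ∃ l, ∀ i ≥ l, f m i = 0) (hΦ : ∑' m, Φ (f m) ≠ ∞)
    {δ : ℝ≥0∞} (hδ : δ ≠ 0) :
    ∃ k, Φ (fun i => if k ≤ i then ∑' m, f m i else 0) ≤ δ := by
  choose l hl using hf
  -- The summands from `m₀` on have total at most `δ`; the supports of the finitely many others end
  -- before `K`.
  obtain ⟨m₀, hm₀⟩ := ((ENNReal.tendsto_sum_nat_add _ hΦ).eventually_le_const
    (pos_iff_ne_zero.2 hδ)).exists
  set K := (Finset.range m₀).sup l with hK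
  refine ⟨K, ?_⟩
  have h : (fun i => if K ≤ i then ∑' m, f m i else 0)
      = fun i => ∑' m, if K ≤ i then f m i else 0 := by
    funext i
    split_ifs <;> simp
  rw [h]
  refine (hsub _).trans ?_
  have hhead : ∑ m ∈ Finset.range m₀, Φ (fun i => if K ≤ i then f m i else 0) = 0 := by
    refine Finset.sum_eq_zero fun m hm => ?_
    have hz : (fun i => if K ≤ i then f m i else 0) = fun _ => 0 := by
      funext i
      split_ifs with hi
      · exact hl m i ((Finset.le_sup hm).trans hi)
      · rfl
    rw [hz, h0]
  have hsplit := (ENNReal.summable).sum_add_tsum_nat_add' (k := m₀)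
    (f := fun m => Φ (fun i => if K ≤ i then f m i else 0))
  rw [hhead, zero_add] at hsplit
  rw [← hsplit]
  refine le_trans (ENNReal.tsum_le_tsum fun m => hmono _ _ fun i => ?_) hm₀
  split_ifs <;> simp

end SpreadNorm

/-! ### Finite vectors whose consecutive copies add up -/

section FlatBlocks

/-- The sequence that equals `h` on its first `L` places and is continued by `u`. -/
def prepend (L : ℕ) (h : ℝ≥0∞) (u : ℕ → ℝ≥0∞) (t : ℕ) : ℝ≥0∞ := if t < L then h else u (t - L)

/-- Head and tail never both count fully. If a set takes at least `m` head entries, the tail only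
gets weights at most `v m` and contributes at most `C`; if it takes at most `m`, the head
contributes at most `C`. -/
theorem spreadNorm_prepend_le {v : ℕ → ℝ≥0∞} (hv : Antitone v) {L m : ℕ} {h C : ℝ≥0∞}
    {u : ℕ → ℝ≥0∞} {l : ℕ} (hl : ∀ t ≥ l, u t = 0) (hL : h * ∑ j ∈ Finset.range L, v j ≤ 1)
    (hm : h * ∑ j ∈ Finset.range m, v j ≤ C) (hu : spreadNorm v u ≤ 1 + C)
    (hum : (∑ t ∈ Finset.range l, u t) * v m ≤ C) :
    spreadNorm v (prepend L h u) ≤ 1 + (C + C) := by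
  classical
  refine iSup_le fun s => ?_
  set s₁ := s.filter (· < L)
  set s₂ := s.filter (¬ · < L)
  have hcard : s₁.card ≤ L := by
    have : s₁ ⊆ Finset.range L := fun t ht => Finset.mem_range.2 (Finset.mem_filter.1 ht).2
    simpa using Finset.card_le_card this
  rw [← Finset.sum_filter_add_sum_filter_not s (· < L)]
  have h1 : ∑ i ∈ s₁, prepend L h u i * v (rankIn s i) ≤
      h * ∑ j ∈ Finset.range s₁.card, v j := by
    rw [← sum_rankIn, Finset.mul_sum]
    refine Finset.sum_le_sum fun i hi => ?_
    rw [prepend, if_pos (Finset.mem_filter.1 hi).2]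
    gcongr
    exact hv (rankIn_mono (Finset.filter_subset _ _) i)
  rcases le_total m s₁.card with hms | hms
  · have h2 : ∑ i ∈ s₂, prepend L h u i * v (rankIn s i) ≤ C := by
      refine le_trans ?_ hum
      have h3 : ∀ i ∈ s₂, prepend L h u i * v (rankIn s i) ≤ u (i - L) * v m := fun i hi => by
        have hi' := (Finset.mem_filter.1 hi).2
        rw [prepend, if_neg hi']
        gcongr
        refine hv (hms.trans (Finset.card_le_card fun k hk => ?_))
        exact Finset.mem_filter.2 ⟨(Finset.mem_filter.1 hk).1,
          (Finset.mem_filter.1 hk).2.trans_le (not_lt.1 hi')⟩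
      refine (Finset.sum_le_sum h3).trans ?_
      rw [← Finset.sum_mul]
      gcongr
      have hinj : Set.InjOn (fun i => i - L) s₂ := fun i hi j hj hij => by
        have := not_lt.1 (Finset.mem_filter.1 hi).2
        have := not_lt.1 (Finset.mem_filter.1 hj).2
        simp only at hij
        omega
      rw [← Finset.sum_image (f := u) hinj]
      refine Finset.sum_le_sum_of_ne_zero fun t _ ht => Finset.mem_range.2 ?_
      by_contra hlt
      exact ht (hl t (not_lt.1 hlt))
    calc _ ≤ 1 + C := add_le_add (h1.trans (le_trans ?_ hL)) h2
      _ ≤ _ := by gcongr; exact le_self_add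
    gcongr
  · have h2 : ∑ i ∈ s₂, prepend L h u i * v (rankIn s i) ≤ 1 + C := by
      refine le_trans ?_ hu
      have h3 : ∑ i ∈ s₂, prepend L h u i * v (rankIn s i) ≤
          spreadNorm v (fun i => if i < L then 0 else u (i - L)) := by
        refine le_trans (Finset.sum_le_sum fun i hi => ?_) (sum_le_spreadNorm _ s₂)
        rw [prepend, if_neg (Finset.mem_filter.1 hi).2, if_neg (Finset.mem_filter.1 hi).2]
        gcongr
        exact hv (rankIn_mono (Finset.filter_subset _ _) i)
      refine h3.trans (spreadNorm_le_of_rel hv (fun i t => i = t + L) (fun i hi => ?_) ?_)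
      · have hiL : ¬ i < L := fun h => hi (if_pos h)
        exact ⟨i - L, by omega, by rw [if_neg hiL]⟩
      · intros
        omega
    calc _ ≤ C + (1 + C) := add_le_add (h1.trans (le_trans ?_ hm)) h2
      _ = _ := by ring
    gcongr

/-- The old selection is kept in the first `N` copies, whose new heads are skipped; the last copy
contributes its head alone, after `s.card` chosen entries. -/
theorem exists_copies_prepend {v : ℕ → ℝ≥0∞} (hv : Antitone v) {L N : ℕ} {h : ℝ≥0∞}
    {u : ℕ → ℝ≥0∞} (s : Finset (ℕ ×ₗ ℕ)) (hs : ∀ x ∈ s, (ofLex x).1 < N) :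
    ∃ s' : Finset (ℕ ×ₗ ℕ), (∀ x ∈ s', (ofLex x).1 < N + 1) ∧
      ∑ x ∈ s, u (ofLex x).2 * v (rankIn s x) + h * ∑ t ∈ Finset.range L, v (s.card + t) ≤
        ∑ x ∈ s', prepend L h u (ofLex x).2 * v (rankIn s' x) := by
  classical
  let f : ℕ ×ₗ ℕ → ℕ ×ₗ ℕ := fun x => toLex ((ofLex x).1, (ofLex x).2 + L)
  let g : ℕ → ℕ ×ₗ ℕ := fun t => toLex (N, t)
  have hf : ∀ x y, f x < f y → x < y := fun x y hxy => by
    rw [Prod.Lex.lt_iff] at hxy ⊢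
    simpa [f] using hxy
  have hfinj : Function.Injective f := fun x y hxy => by
    have h1 : ((ofLex x).1, (ofLex x).2 + L) = ((ofLex y).1, (ofLex y).2 + L) := toLex.injective hxy
    simp only [Prod.mk.injEq, add_left_inj] at h1
    exact ofLex.injective (Prod.ext h1.1 h1.2)
  have hginj : Function.Injective g := fun x y hxy => by
    have h1 : (N, x) = (N, y) := toLex.injective hxy
    simpa using h1
  have hdisj : Disjoint (s.image f) ((Finset.range L).image g) := by
    rw [Finset.disjoint_left]
    intro x hx hx'
    obtain ⟨y, hy, rfl⟩ := Finset.mem_image.1 hx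
    obtain ⟨t, -, ht⟩ := Finset.mem_image.1 hx'
    have h1 : (N, t) = ((ofLex y).1, (ofLex y).2 + L) := toLex.injective ht
    simp only [Prod.mk.injEq] at h1
    exact (hs y hy).ne h1.1.symm
  refine ⟨s.image f ∪ (Finset.range L).image g, ?_, ?_⟩
  · intro x hx
    rcases Finset.mem_union.1 hx with hx | hx
    · obtain ⟨y, hy, rfl⟩ := Finset.mem_image.1 hx
      exact (hs y hy).trans (Nat.lt_succ_self N)
    · obtain ⟨y, hy, rfl⟩ := Finset.mem_image.1 hx
      exact Nat.lt_succ_self N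
  · rw [Finset.sum_union hdisj, Finset.sum_image hfinj.injOn, Finset.sum_image hginj.injOn,
      Finset.mul_sum]
    refine add_le_add (Finset.sum_le_sum fun x hx => ?_) (Finset.sum_le_sum fun t ht => ?_)
    · have h1 : prepend L h u (ofLex (f x)).2 = u (ofLex x).2 := by simp [prepend, f]
      rw [h1]
      gcongr
      refine hv ((Finset.card_le_card ?_).trans (Finset.card_image_le (f := f)))
      intro y hy
      obtain ⟨hy1, hy2⟩ := Finset.mem_filter.1 hy
      rcases Finset.mem_union.1 hy1 with hy1 | hy1
      · obtain ⟨z, hz, rfl⟩ := Finset.mem_image.1 hy1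
        exact Finset.mem_image_of_mem _ (Finset.mem_filter.2 ⟨hz, hf _ _ hy2⟩)
      · obtain ⟨z, hz, rfl⟩ := Finset.mem_image.1 hy1
        have := hs x hx
        rw [Prod.Lex.lt_iff] at hy2
        simp only [f, g, ofLex_toLex] at hy2
        omega
    · have h1 : prepend L h u (ofLex (g t)).2 = h := by
        simp [prepend, g, Finset.mem_range.1 ht]
      rw [h1]
      gcongr
      refine hv ?_
      have h2 : (s.image f ∪ (Finset.range L).image g).filter (· < g t) ⊆
          s.image f ∪ (Finset.range t).image g := by
        intro y hy
        obtain ⟨hy1, hy2⟩ := Finset.mem_filter.1 hy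
        rcases Finset.mem_union.1 hy1 with hy1 | hy1
        · exact Finset.mem_union_left _ hy1
        · obtain ⟨z, hz, rfl⟩ := Finset.mem_image.1 hy1
          refine Finset.mem_union_right _ (Finset.mem_image_of_mem _ (Finset.mem_range.2 ?_))
          rw [Prod.Lex.lt_iff] at hy2
          simpa [g] using hy2
      refine (Finset.card_le_card h2).trans ((Finset.card_union_le _ _).trans ?_)
      exact add_le_add Finset.card_image_le (Finset.card_image_le.trans (by simp))

/-- Induction on `N`, prepending a plateau of functional 1. It is so long that losing the first
`s.card` weights hardly matters, so in the last copy it still adds almost 1. Each step spends half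
of `δ` on the norm and half on the count. -/
theorem exists_copies {v : ℕ → ℝ≥0∞} (hv : Antitone v) (hv0 : v 0 = 1)
    (hlim : Tendsto v atTop (𝓝 0)) (hsum : ∑' j, v j = ∞) (N : ℕ) :
    ∀ δ : ℝ≥0∞, δ ≠ 0 → δ ≠ ∞ → ∃ (u : ℕ → ℝ≥0∞) (l : ℕ), (∀ t ≥ l, u t = 0) ∧ (∀ t, u t ≠ ∞) ∧
      spreadNorm v u ≤ 1 + δ ∧ ∃ s : Finset (ℕ ×ₗ ℕ), (∀ x ∈ s, (ofLex x).1 < N) ∧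
        (N : ℝ≥0∞) ≤ ∑ x ∈ s, u (ofLex x).2 * v (rankIn s x) + δ := by
  have hvtop : ∀ j, v j ≠ ∞ := fun j =>
    ((hv (Nat.zero_le j)).trans_lt (hv0.trans_lt ENNReal.one_lt_top)).ne
  have hStop : ∀ n, ∑ j ∈ Finset.range n, v j ≠ ∞ := fun n => ENNReal.sum_ne_top.2 fun j _ => hvtop j
  induction N with
  | zero =>
    intro δ _ _
    exact ⟨fun _ => 0, 0, fun _ _ => rfl, by simp, by simp [spreadNorm_zero], ∅, by simp, by simp⟩
  | succ N ih =>
    intro δ hδ hδt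
    have hδ2 : δ / 2 ≠ 0 := (ENNReal.half_pos hδ).ne'
    have hδ2t : δ / 2 ≠ ∞ := (ENNReal.div_lt_top hδt two_ne_zero).ne
    obtain ⟨u, l, hl, hu, hun, s, hs, hN⟩ := ih (δ / 2) hδ2 hδ2t
    have hM : ∑ t ∈ Finset.range l, u t ≠ ∞ := ENNReal.sum_ne_top.2 fun t _ => hu t
    have hR : ∀ᶠ m in atTop, (∑ t ∈ Finset.range l, u t) * v m ≤ δ / 2 := by
      have := ENNReal.Tendsto.const_mul (a := ∑ t ∈ Finset.range l, u t) hlim (Or.inr hM)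
      rw [mul_zero] at this
      exact this.eventually_le_const (pos_iff_ne_zero.2 hδ2)
    -- The number `m` serves twice: weights from `v m` on make the old vector negligible, and `m ≥
    -- s.card` bounds the weights lost by the last head.
    obtain ⟨m, hm, hsm⟩ := (hR.and (eventually_ge_atTop s.card)).exists
    have hdiv : (∑ j ∈ Finset.range m, v j) / (δ / 2) < ∞ := ENNReal.div_lt_top (hStop m) hδ2
    have hS := ENNReal.tendsto_nat_tsum v
    rw [hsum] at hS
    -- The first `m` weights make up at most the fraction `δ / 2` of the first `L`.
    obtain ⟨L, hL, hL1⟩ := ((hS.eventually (lt_mem_nhds hdiv)).and (eventually_ge_atTop 1)).exists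
    set S := ∑ j ∈ Finset.range L, v j with hSdef
    have hS0 : S ≠ 0 := by
      have : v 0 ≤ S := Finset.single_le_sum (fun _ _ => zero_le) (Finset.mem_range.2 hL1)
      rw [hv0] at this
      exact (zero_lt_one.trans_le this).ne'
    have hmS : S⁻¹ * ∑ j ∈ Finset.range m, v j ≤ δ / 2 := by
      rw [mul_comm, ← div_eq_mul_inv]
      exact ENNReal.div_le_of_le_mul' (((ENNReal.div_le_iff' hδ2 hδ2t).1 hL.le).trans_eq (mul_comm _ _))
    obtain ⟨s', hs', hsum'⟩ := exists_copies_prepend hv (L := L) (h := S⁻¹) (u := u) s hs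
    refine ⟨prepend L S⁻¹ u, L + l, fun t ht => ?_, fun t => ?_, ?_, s', hs', ?_⟩
    · rw [prepend, if_neg (by omega)]
      exact hl _ (by omega)
    · rw [prepend]
      split_ifs
      · exact ENNReal.inv_ne_top.2 hS0
      · exact hu _
    · have := spreadNorm_prepend_le hv (L := L) hl (ENNReal.inv_mul_cancel hS0 (hStop L)).le hmS
        hun hm
      rwa [ENNReal.add_halves] at this
    · have h1 : 1 ≤ S⁻¹ * ∑ t ∈ Finset.range L, v (s.card + t) + δ / 2 := by
        calc (1 : ℝ≥0∞) = S⁻¹ * S := (ENNReal.inv_mul_cancel hS0 (hStop L)).symm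
          _ ≤ S⁻¹ * (∑ j ∈ Finset.range m, v j + ∑ t ∈ Finset.range L, v (s.card + t)) := by
            gcongr
            calc S ≤ ∑ j ∈ Finset.range (s.card + L), v j :=
                  Finset.sum_le_sum_of_subset (Finset.range_mono (Nat.le_add_left _ _))
              _ = ∑ j ∈ Finset.range s.card, v j + ∑ t ∈ Finset.range L, v (s.card + t) :=
                  Finset.sum_range_add _ _ _
              _ ≤ _ := by gcongr
          _ ≤ _ := by
            rw [mul_add, add_comm]
            gcongr
      calc ((N + 1 : ℕ) : ℝ≥0∞) = N + 1 := by push_cast; rfl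
        _ ≤ (∑ x ∈ s, u (ofLex x).2 * v (rankIn s x) + δ / 2) +
            (S⁻¹ * ∑ t ∈ Finset.range L, v (s.card + t) + δ / 2) := add_le_add hN h1
        _ = (∑ x ∈ s, u (ofLex x).2 * v (rankIn s x) +
            S⁻¹ * ∑ t ∈ Finset.range L, v (s.card + t)) + (δ / 2 + δ / 2) := by ring
        _ ≤ _ := by rw [ENNReal.add_halves]; gcongr

end FlatBlocks

/-! ### A sequence whose pieces are detected by numbers of copies -/

section Profile

/-- The sequence `1, …, 1, 0, 0, …` with `N` ones. -/
def ones (N n : ℕ) : ℝ≥0∞ := if n < N then 1 else 0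

theorem tsum_ones (N : ℕ) : ∑' n, ones N n = N := by
  have h : ∀ n ∉ Finset.range N, ones N n = 0 := fun n hn => if_neg (Finset.mem_range.not.1 hn)
  have h' : ∀ n ∈ Finset.range N, ones N n = 1 := fun n hn => if_pos (Finset.mem_range.1 hn)
  rw [tsum_eq_sum h, Finset.sum_congr rfl h']
  simp

/-- The averages of a null sequence tend to 0. -/
theorem exists_mul_sum_le {v : ℕ → ℝ≥0∞} (hv : Antitone v) (hv0 : v 0 = 1)
    (hlim : Tendsto v atTop (𝓝 0)) {K δ : ℝ≥0∞} (hK : K ≠ ∞) (hδ : δ ≠ 0) (hδt : δ ≠ ∞) :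
    ∃ N : ℕ, 2 ≤ N ∧ K * ∑ j ∈ Finset.range N, v j ≤ δ * N := by
  have hvtop : ∀ j, v j ≠ ∞ := fun j =>
    ((hv (Nat.zero_le j)).trans_lt (hv0.trans_lt ENNReal.one_lt_top)).ne
  have hδ2 : δ / 2 ≠ 0 := (ENNReal.half_pos hδ).ne'
  have hδ2t : δ / 2 ≠ ∞ := (ENNReal.div_lt_top hδt two_ne_zero).ne
  have h1 := ENNReal.Tendsto.const_mul (a := K) hlim (Or.inr hK)
  rw [mul_zero] at h1
  obtain ⟨m, hm⟩ := (h1.eventually_le_const (pos_iff_ne_zero.2 hδ2)).exists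
  have hdiv : (K * ∑ j ∈ Finset.range m, v j) / (δ / 2) < ∞ :=
    ENNReal.div_lt_top (ENNReal.mul_ne_top hK (ENNReal.sum_ne_top.2 fun j _ => hvtop j)) hδ2
  obtain ⟨N, hN, hN2⟩ := ((ENNReal.tendsto_nat_nhds_top.eventually (lt_mem_nhds hdiv)).and
    (eventually_ge_atTop 2)).exists
  refine ⟨N, hN2, ?_⟩
  calc K * ∑ j ∈ Finset.range N, v j
      ≤ K * (∑ j ∈ Finset.range m, v j + N * v m) := by
        gcongr
        calc ∑ j ∈ Finset.range N, v j ≤ ∑ j ∈ Finset.range (m + N), v j :=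
              Finset.sum_le_sum_of_subset (Finset.range_mono (Nat.le_add_left _ _))
          _ = ∑ j ∈ Finset.range m, v j + ∑ j ∈ Finset.range N, v (m + j) :=
              Finset.sum_range_add _ _ _
          _ ≤ _ := by
              gcongr
              refine (Finset.sum_le_sum fun j _ => hv (Nat.le_add_right m j)).trans ?_
              simp
    _ = K * ∑ j ∈ Finset.range m, v j + (K * v m) * N := by ring
    _ ≤ δ / 2 * N + δ / 2 * N := by
        exact add_le_add ((ENNReal.div_le_iff' hδ2 hδ2t).1 hN.le) (mul_le_mul_left hm _)
    _ = δ * N := by rw [← add_mul, ENNReal.add_halves]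

/-- Alternating choice: `N m` is large compared with the mass of `u 0, …, u m`, so that `N m` copies
of these are negligible; then `u (m + 1)` is chosen so that its `N m` copies add up. -/
theorem exists_groups {v : ℕ → ℝ≥0∞} (hv : Antitone v) (hv0 : v 0 = 1)
    (hlim : Tendsto v atTop (𝓝 0)) (hsum : ∑' j, v j = ∞) (δ : ℕ → ℝ≥0∞) (hδ : ∀ m, δ m ≠ 0)
    (hδt : ∀ m, δ m ≠ ∞) :
    ∃ (u : ℕ → ℕ → ℝ≥0∞) (N : ℕ → ℕ), (u 0 = fun t => if t = 0 then 1 else 0) ∧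
      (∀ m, ∃ l, ∀ t ≥ l, u m t = 0) ∧ (∀ m, spreadNorm v (u m) ≤ 2) ∧ (∀ m, 2 ≤ N m) ∧
      (∀ m, (N m : ℝ≥0∞) ≤ tensorNorm v (u (m + 1)) (ones (N m)) + 1) ∧
      ∀ m, (∑ l ∈ Finset.range (m + 1), ∑' t, u l t) * ∑ j ∈ Finset.range (N m), v j
        ≤ δ m * N m := by
  have key : ∀ (m : ℕ) (K : NNReal), ∃ (N : ℕ) (u : ℕ → ℝ≥0∞), (∃ l, ∀ t ≥ l, u t = 0) ∧
      (∑' t, u t ≠ ∞) ∧ spreadNorm v u ≤ 2 ∧ 2 ≤ N ∧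
      (N : ℝ≥0∞) ≤ tensorNorm v u (ones N) + 1 ∧
      K * ∑ j ∈ Finset.range N, v j ≤ δ m * N := by
    intro m K
    obtain ⟨N, hN2, hN⟩ := exists_mul_sum_le hv hv0 hlim (K := (K : ℝ≥0∞)) ENNReal.coe_ne_top (hδ m) (hδt m)
    obtain ⟨u, l, hl, hut, hu, s, hs, hsum⟩ :=
      exists_copies hv hv0 hlim hsum N 1 one_ne_zero ENNReal.one_ne_top
    refine ⟨N, u, ⟨l, hl⟩, ?_, hu.trans_eq one_add_one_eq_two, hN2, hsum.trans ?_, hN⟩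
    · rw [tsum_eq_sum (s := Finset.range l) fun t ht =>
        hl t (not_lt.1 (Finset.mem_range.not.1 ht))]
      exact ENNReal.sum_ne_top.2 fun t _ => hut t
    · gcongr
      refine le_trans (Finset.sum_le_sum fun x hx => ?_) (sum_le_spreadNorm _ s)
      rw [ones, if_pos (hs x hx), one_mul]
  choose Nf uf h1 h2 h3 h4 h5 h6 using key
  -- The recursion only has to remember a bound for the mass used so far; it starts with 1, the mass
  -- of `u 0`.
  let K : ℕ → NNReal := fun m => Nat.rec 1 (fun m k => k + (∑' t, uf m k t).toNNReal) m
  have hK : ∀ m, K (m + 1) = K m + (∑' t, uf m (K m) t).toNNReal := fun m => rfl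
  let u : ℕ → ℕ → ℝ≥0∞ := fun m => Nat.casesOn m (fun t => if t = 0 then 1 else 0)
    fun m => uf m (K m)
  have hmass : ∀ m, ∑ l ∈ Finset.range (m + 1), ∑' t, u l t ≤ ENNReal.ofNNReal (K m) := by
    intro m
    induction m with
    | zero => simp [u, K]
    | succ m ih =>
      rw [Finset.sum_range_succ, hK, ENNReal.coe_add, ENNReal.coe_toNNReal (h2 _ _)]
      exact add_le_add ih le_rfl
  refine ⟨u, fun m => Nf m (K m), rfl, fun m => ?_, fun m => ?_, fun m => h4 _ _,
    fun m => h5 _ _, fun m => le_trans ?_ (h6 m (K m))⟩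
  · cases m with
    | zero => exact ⟨1, fun t ht => if_neg (by omega)⟩
    | succ m => exact h1 _ _
  · cases m with
    | zero =>
      refine (spreadNorm_indicator_le hv {0} (fun t => ?_) (fun t ht => ?_)).trans ?_
      · change (if t = 0 then (1 : ℝ≥0∞) else 0) ≤ 1
        split_ifs <;> simp
      · change (if t = 0 then (1 : ℝ≥0∞) else 0) = 0
        exact if_neg (by simpa using ht)
      · simp [hv0]
    | succ m => exact h3 _ _
  · gcongr
    exact hmass m

/-- The entries of `c` at the places `⟨m, t⟩` with `m = 0` or `m - 1 ∈ A`. -/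
noncomputable def maskSeq (A : Set ℕ) (c : ℕ → ℝ≥0∞) (i : ℕ) : ℝ≥0∞ :=
  open Classical in if ∀ m, (Nat.unpair i).1 = m + 1 → m ∈ A then c i else 0

theorem maskSeq_le (A : Set ℕ) (c : ℕ → ℝ≥0∞) (i : ℕ) : maskSeq A c i ≤ c i := by
  rw [maskSeq]
  split_ifs <;> simp

/-- The squares in the exponent make the tail after `m` small even relative to the `m`-th term,
which a geometric sequence would not do. -/
theorem summable_scale (m : ℕ) :
    ∑' l, (2⁻¹ : ℝ≥0∞) ^ ((m + 1 + l) * (m + 1 + l)) ≤ 2⁻¹ ^ m * 2⁻¹ ^ (m * m) := by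
  have h : ∑' l, (2⁻¹ : ℝ≥0∞) ^ (l + 1) = 1 := by
    rw [ENNReal.tsum_geometric_add_one, ENNReal.one_sub_inv_two, inv_inv]
    exact ENNReal.inv_mul_cancel two_ne_zero ENNReal.ofNat_ne_top
  calc ∑' l, (2⁻¹ : ℝ≥0∞) ^ ((m + 1 + l) * (m + 1 + l))
      ≤ ∑' l, 2⁻¹ ^ m * 2⁻¹ ^ (m * m) * 2⁻¹ ^ (l + 1) := by
        refine ENNReal.tsum_le_tsum fun l => ?_
        rw [← pow_add, ← pow_add]
        refine pow_le_pow_right_of_le_one' (ENNReal.inv_le_one.2 one_le_two) ?_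
        nlinarith [Nat.zero_le (m * l), Nat.zero_le (l * l)]
    _ = _ := by rw [ENNReal.tsum_mul_left, h, mul_one]

theorem tsum_place (f : ℕ → ℕ → ℝ≥0∞) (i : ℕ) :
    ∑' m, (if (Nat.unpair i).1 = m then f m (Nat.unpair i).2 else 0) =
      f (Nat.unpair i).1 (Nat.unpair i).2 := by
  rw [tsum_eq_single (Nat.unpair i).1 fun n hn => if_neg hn.symm, if_pos rfl]

/-- The relation between places `⟨m, t⟩` and `t`, for a fixed `m`. -/
theorem place_strictMono (m : ℕ) (i i' k k' : ℕ)
    (h : (Nat.unpair i).1 = m ∧ (Nat.unpair i).2 = k)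
    (h' : (Nat.unpair i').1 = m ∧ (Nat.unpair i').2 = k') : i < i' ↔ k < k' := by
  obtain ⟨h1, rfl⟩ := h
  obtain ⟨h2, rfl⟩ := h'
  conv_lhs => rw [← Nat.pair_unpair i, ← Nat.pair_unpair i', h1, h2]
  exact (strictMono_nat_of_lt_succ fun t => Nat.pair_lt_pair_right m t.lt_succ_self).lt_iff_lt

/-- A sequence `c` whose parts given by sets `A` of natural numbers are told apart by finitely
supported sequences `b`. -/
theorem exists_profile {v : ℕ → ℝ≥0∞} (hv : Antitone v) (hv0 : v 0 = 1)
    (hlim : Tendsto v atTop (𝓝 0)) (hsum : ∑' j, v j = ∞) :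
    ∃ c : ℕ → ℝ≥0∞, c 0 = 1 ∧ spreadNorm v c ≠ ∞ ∧
      (∀ δ : ℝ≥0∞, δ ≠ 0 → ∃ k, spreadNorm v (fun i => if k ≤ i then c i else 0) ≤ δ) ∧
      ∀ m : ℕ, ∃ b : ℕ → ℝ≥0∞, (∃ l, ∀ n ≥ l, b n = 0) ∧ (∀ n, b n ≠ ∞) ∧
        ∀ A : Set ℕ, (m ∈ A → 1 ≤ 2 * tensorNorm v (maskSeq A c) b) ∧
          (m ∉ A → tensorNorm v (maskSeq A c) b ≤ 3 * 2⁻¹ ^ (m + 1)) := by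
  set ε : ℕ → ℝ≥0∞ := fun m => 2⁻¹ ^ (m * m) with hε
  have hε0 : ∀ m, ε m ≠ 0 := fun m => pow_ne_zero _ (by simp)
  have hε1 : ∀ m, ε m ≤ 1 := fun m => pow_le_one' (ENNReal.inv_le_one.2 one_le_two) _
  have hεt : ∀ m, ε m ≠ ∞ := fun m => ((hε1 m).trans_lt ENNReal.one_lt_top).ne
  have hη0 : ∀ m : ℕ, (2⁻¹ : ℝ≥0∞) ^ m ≠ 0 := fun m => pow_ne_zero _ (by simp)
  have hηt : ∀ m : ℕ, (2⁻¹ : ℝ≥0∞) ^ m ≠ ∞ := fun m => ENNReal.pow_ne_top (by simp)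
  obtain ⟨u, N, hu0, hul, hu2, hN2, hN, hmass⟩ := exists_groups hv hv0 hlim hsum
    (fun m => 2⁻¹ ^ (m + 1) * ε (m + 1)) (fun m => mul_ne_zero (hη0 _) (hε0 _))
    (fun m => ENNReal.mul_ne_top (hηt _) (hεt _))
  -- The `m`-th piece of `c`. The places `⟨m, t⟩` increase with `t`, so its functionals are those of
  -- `ε m * u m`.
  let f : ℕ → ℕ → ℝ≥0∞ := fun m i =>
    if (Nat.unpair i).1 = m then ε m * u m (Nat.unpair i).2 else 0
  let c : ℕ → ℝ≥0∞ := fun i => ε (Nat.unpair i).1 * u (Nat.unpair i).1 (Nat.unpair i).2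
  have hc : ∀ i, c i = ∑' m, f m i := fun i => (tsum_place (fun m t => ε m * u m t) i).symm
  have hfle : ∀ m (b : ℕ → ℝ≥0∞), tensorNorm v (f m) b ≤ ε m * tensorNorm v (u m) b := by
    intro m b
    rw [← tensorNorm_const_mul_left]
    refine tensorNorm_le_of_rel hv (fun i t => (Nat.unpair i).1 = m ∧ (Nat.unpair i).2 = t) Eq
      (fun i hi => ?_) (fun i i' k k' h h' hlt => (place_strictMono m i i' k k' h h').1 hlt)
      (fun n _ => ⟨n, rfl, le_rfl⟩) (by rintro i i' _ _ rfl rfl h; exact h)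
      (by rintro i _ _ rfl rfl; rfl)
    have him : (Nat.unpair i).1 = m := by
      by_contra h
      exact hi (if_neg h)
    exact ⟨_, ⟨him, rfl⟩, by simp [f, him]⟩
  have hlef : ∀ m (b : ℕ → ℝ≥0∞), ε m * tensorNorm v (u m) b ≤ tensorNorm v (f m) b := by
    intro m b
    rw [← tensorNorm_const_mul_left]
    refine tensorNorm_le_of_rel hv (fun t i => (Nat.unpair i).1 = m ∧ (Nat.unpair i).2 = t) Eq
      (fun t _ => ⟨Nat.pair m t, by simp, by simp [f]⟩)
      (fun k k' i i' h h' hlt => (place_strictMono m i i' k k' h h').2 hlt)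
      (fun n _ => ⟨n, rfl, le_rfl⟩) (by rintro i i' _ _ rfl rfl h; exact h)
      (by rintro i _ _ rfl rfl; rfl)
  have hf2 : ∀ m, spreadNorm v (f m) ≤ ε m * 2 := by
    intro m
    refine le_trans ?_ (mul_le_mul_right (hu2 m) _)
    rw [← spreadNorm_const_mul]
    refine spreadNorm_le_of_rel hv (fun i t => (Nat.unpair i).1 = m ∧ (Nat.unpair i).2 = t)
      (fun i hi => ?_) (fun i i' k k' h h' hlt => (place_strictMono m i i' k k' h h').1 hlt)
    have him : (Nat.unpair i).1 = m := by
      by_contra h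
      exact hi (if_neg h)
    exact ⟨_, ⟨him, rfl⟩, by simp [f, him]⟩
  have htail : ∀ m, ∑' l, ε (m + 1 + l) ≤ 2⁻¹ ^ m * ε m := summable_scale
  have hΦ : ∑' m, spreadNorm v (f m) ≠ ∞ := by
    refine ((ENNReal.tsum_le_tsum hf2).trans_lt ?_).ne
    rw [ENNReal.tsum_mul_right, tsum_eq_zero_add' ENNReal.summable]
    have h := htail 0
    simp only [zero_add, Nat.add_comm 1, pow_zero, one_mul] at h
    refine ENNReal.mul_lt_top (ENNReal.add_lt_top.2 ⟨(hεt 0).lt_top, ?_⟩) ENNReal.ofNat_lt_top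
    exact h.trans_lt (hεt 0).lt_top
  refine ⟨c, by simp [c, hε, hu0], ?_, fun δ hδ => ?_, fun m => ?_⟩
  · rw [show c = fun i => ∑' m, f m i from funext hc]
    exact ((spreadNorm_tsum_le f).trans_lt hΦ.lt_top).ne
  · simp only [hc]
    refine exists_tail_le (fun _ _ => spreadNorm_mono) spreadNorm_tsum_le spreadNorm_zero f
      (fun m => ?_) hΦ hδ
    obtain ⟨l, hl⟩ := hul m
    refine ⟨Nat.pair m l, fun i hi => ?_⟩
    by_cases him : (Nat.unpair i).1 = m
    · simp only [f, if_pos him]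
      rw [hl, mul_zero]
      by_contra hlt
      exact absurd ((place_strictMono m i _ _ l ⟨him, rfl⟩ (by simp)).2 (not_le.1 hlt)) hi.not_gt
    · exact if_neg him
  · set a : ℝ≥0∞ := ε (m + 1) * N m with ha
    have hNne : (N m : ℝ≥0∞) ≠ 0 := by
      have := hN2 m
      exact_mod_cast (by omega : N m ≠ 0)
    have ha0 : a ≠ 0 := mul_ne_zero (hε0 _) hNne
    have hat : a ≠ ∞ := ENNReal.mul_ne_top (hεt _) (ENNReal.natCast_ne_top _)
    -- The test is `N m` ones, normalized by the size `a` that piece `m + 1` reaches on them up to a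
    -- constant.
    refine ⟨fun n => a⁻¹ * ones (N m) n, ⟨N m, fun n hn => ?_⟩, fun n => ?_, fun A => ⟨fun hA => ?_,
      fun hA => ?_⟩⟩
    · simp [ones, not_lt.2 hn]
    · refine ENNReal.mul_ne_top (ENNReal.inv_ne_top.2 ha0) ?_
      rw [ones]
      split_ifs <;> simp
    · rw [tensorNorm_const_mul_right]
      have h1 : (N m : ℝ≥0∞) ≤ 2 * tensorNorm v (u (m + 1)) (ones (N m)) := by
        have h2 : (2 : ℝ≥0∞) ≤ N m := by exact_mod_cast hN2 m
        have h3 : 1 ≤ tensorNorm v (u (m + 1)) (ones (N m)) := by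
          have h4 := h2.trans (hN m)
          rw [← one_add_one_eq_two] at h4
          exact (ENNReal.add_le_add_iff_right ENNReal.one_ne_top).1 h4
        refine (hN m).trans ?_
        rw [two_mul]
        gcongr
      have h2 : tensorNorm v (f (m + 1)) (ones (N m)) ≤
          tensorNorm v (maskSeq A c) (ones (N m)) := by
        refine tensorNorm_mono (fun i => ?_) fun _ => le_rfl
        by_cases him : (Nat.unpair i).1 = m + 1
        · rw [maskSeq, if_pos fun k hk => by rwa [Nat.succ_injective (hk.symm.trans him)]]
          simp [f, c, him]
        · simp [f, him]
      calc (1 : ℝ≥0∞) = a⁻¹ * a := (ENNReal.inv_mul_cancel ha0 hat).symm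
        _ ≤ a⁻¹ * (ε (m + 1) * (2 * tensorNorm v (u (m + 1)) (ones (N m)))) := by
          rw [ha]
          gcongr
        _ = 2 * (a⁻¹ * (ε (m + 1) * tensorNorm v (u (m + 1)) (ones (N m)))) := by ring
        _ ≤ _ := by
          gcongr
          exact (hlef _ _).trans h2
    · rw [tensorNorm_const_mul_right]
      have h1 : tensorNorm v (maskSeq A c) (ones (N m)) ≤
          ∑' l, if l = m + 1 then 0 else tensorNorm v (f l) (ones (N m)) := by
        have h2 : ∀ i, maskSeq A c i ≤ ∑' l, if l = m + 1 then 0 else f l i := fun i => by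
          by_cases him : (Nat.unpair i).1 = m + 1
          · rw [maskSeq, if_neg fun h => hA (h m him)]
            exact zero_le
          · refine (maskSeq_le A c i).trans ((le_of_eq ?_).trans (ENNReal.le_tsum (Nat.unpair i).1))
            simp [him, f, c]
        refine (tensorNorm_mono h2 fun _ => le_rfl).trans ((tensorNorm_tsum_left_le _ _).trans ?_)
        refine ENNReal.tsum_le_tsum fun l => ?_
        split_ifs with h
        · simp [tensorNorm, spreadNorm_zero]
        · exact le_rfl
      -- Earlier pieces: `N m` was chosen large against their mass.
      have h3 : ∑ l ∈ Finset.range (m + 1), tensorNorm v (f l) (ones (N m)) ≤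
          2⁻¹ ^ (m + 1) * a := by
        calc _ ≤ ∑ l ∈ Finset.range (m + 1), (∑' t, u l t) * ∑ j ∈ Finset.range (N m), v j := by
              refine Finset.sum_le_sum fun l _ => (hfle l _).trans ?_
              exact (mul_le_of_le_one_left' (hε1 l)).trans (tensorNorm_indicator_le hv _ _)
          _ ≤ _ := by
              rw [← Finset.sum_mul, ha, ← mul_assoc]
              exact hmass m
      -- Later pieces: the trivial bound `2 * N m` suffices, because their factors `ε` are tiny
      -- compared with `ε (m + 1)`.
      have h4 : ∑' l, tensorNorm v (f (m + 1 + 1 + l)) (ones (N m)) ≤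
          2 * (2⁻¹ ^ (m + 1) * a) := by
        calc _ ≤ ∑' l, ε (m + 1 + 1 + l) * (N m * 2) := by
              refine ENNReal.tsum_le_tsum fun l => (hfle _ _).trans ?_
              gcongr
              refine (tensorNorm_le_tsum_mul hv _ _).trans ?_
              rw [tsum_ones]
              gcongr
              exact hu2 _
          _ ≤ 2⁻¹ ^ (m + 1) * ε (m + 1) * (N m * 2) := by
              rw [ENNReal.tsum_mul_right]
              gcongr
              exact htail (m + 1)
          _ = _ := by rw [ha]; ring
      have h5 : tensorNorm v (maskSeq A c) (ones (N m)) ≤ 3 * (2⁻¹ ^ (m + 1) * a) := by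
        refine h1.trans ?_
        rw [← (ENNReal.summable).sum_add_tsum_nat_add' (k := m + 1 + 1), Finset.sum_range_succ,
          if_pos rfl, add_zero, show (3 : ℝ≥0∞) = 1 + 2 by norm_num, add_mul, one_mul]
        refine add_le_add (le_trans (Finset.sum_le_sum fun l hl => ?_) h3)
          (le_trans (ENNReal.tsum_le_tsum fun l => ?_) h4)
        · split_ifs <;> simp
        · rw [if_neg (by omega), Nat.add_comm l]
      calc a⁻¹ * tensorNorm v (maskSeq A c) (ones (N m)) ≤ a⁻¹ * (3 * (2⁻¹ ^ (m + 1) * a)) := by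
            gcongr
        _ = 3 * 2⁻¹ ^ (m + 1) * (a⁻¹ * a) := by ring
        _ = _ := by rw [ENNReal.inv_mul_cancel ha0 hat, mul_one]

end Profile

/-! ### The Garling quasi-norm as a supremum over finite sets -/

noncomputable section

section GarlingBasic

variable {𝕜 : Type*} [RCLike 𝕜] {w : ℕ → ℝ} {p : ℝ}

theorem tsum_le_spreadNorm (v c : ℕ → ℝ≥0∞) {φ : ℕ → ℕ} (hφ : StrictMono φ) :
    ∑' j, c (φ j) * v j ≤ spreadNorm v c := by
  classical
  rw [ENNReal.tsum_eq_iSup_nat]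
  refine iSup_le fun n => ?_
  refine le_trans (le_of_eq ?_) (sum_le_spreadNorm c ((Finset.range n).image φ))
  rw [Finset.sum_image hφ.injective.injOn]
  refine Finset.sum_congr rfl fun j hj => ?_
  have h : ((Finset.range n).image φ).filter (· < φ j) = (Finset.range j).image φ := by
    ext i
    simp only [Finset.mem_filter, Finset.mem_image, Finset.mem_range]
    constructor
    · rintro ⟨⟨k, -, rfl⟩, hk⟩
      exact ⟨k, hφ.lt_iff_lt.1 hk, rfl⟩
    · rintro ⟨k, hk, rfl⟩
      exact ⟨⟨k, hk.trans (Finset.mem_range.1 hj), rfl⟩, hφ hk⟩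
  rw [rankIn, h, Finset.card_image_of_injective _ hφ.injective, Finset.card_range]

/-- Enumerating `s` followed by all numbers beyond its maximum gives an increasing map; the
additional terms are nonnegative. -/
theorem exists_sum_le_tsum (v c : ℕ → ℝ≥0∞) (s : Finset ℕ) :
    ∃ φ : ℕ → ℕ, StrictMono φ ∧ ∑ i ∈ s, c i * v (rankIn s i) ≤ ∑' j, c (φ j) * v j := by
  classical
  let P : ℕ → Prop := fun i => i ∈ s ∨ s.sup id < i
  have hinf : {i | P i}.Infinite := (Set.Ioi_infinite (s.sup id)).mono fun i hi => Or.inr hi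
  have hcount : ∀ i ∈ s, Nat.count P i = rankIn s i := fun i hi => by
    rw [Nat.count_eq_card_filter_range, rankIn]
    congr 1
    ext k
    simp only [Finset.mem_filter, Finset.mem_range, P]
    constructor
    · rintro ⟨h1, h2 | h2⟩
      · exact ⟨h2, h1⟩
      · exact absurd (h1.trans_le (Finset.le_sup (f := id) hi)) h2.not_gt
    · rintro ⟨h1, h2⟩
      exact ⟨h2, Or.inl h1⟩
  have hnth : ∀ i ∈ s, Nat.nth P (rankIn s i) = i := fun i hi => by
    rw [← hcount i hi]
    exact Nat.nth_count (Or.inl hi)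
  refine ⟨Nat.nth P, Nat.nth_strictMono hinf, ?_⟩
  have hinj : Set.InjOn (rankIn s) s := fun i hi j hj hij => by
    rw [← hnth i hi, hij, hnth j hj]
  calc ∑ i ∈ s, c i * v (rankIn s i) = ∑ j ∈ s.image (rankIn s), c (Nat.nth P j) * v j := by
        rw [Finset.sum_image hinj]
        exact Finset.sum_congr rfl fun i hi => by rw [hnth i hi]
    _ ≤ _ := ENNReal.sum_le_tsum _

theorem garlingENorm_eq_spreadNorm (hp : 0 < p) (a : ℕ → 𝕜) :
    garlingENorm w p a =
      spreadNorm (fun j => ENNReal.ofReal (w j)) (fun i => ‖a i‖ₑ ^ p) ^ (1 / p) := by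
  refine le_antisymm (iSup₂_le fun φ hφ => ?_) ?_
  · exact ENNReal.rpow_le_rpow
      (tsum_le_spreadNorm (fun j => ENNReal.ofReal (w j)) (fun i => ‖a i‖ₑ ^ p) hφ) (by positivity)
  · rw [one_div, ENNReal.rpow_inv_le_iff hp]
    refine iSup_le fun s => ?_
    obtain ⟨φ, hφ, hs⟩ :=
      exists_sum_le_tsum (fun j => ENNReal.ofReal (w j)) (fun i => ‖a i‖ₑ ^ p) s
    refine hs.trans ?_
    rw [← ENNReal.rpow_inv_le_iff hp, ← one_div]
    exact le_iSup₂ (f := fun (φ : ℕ → ℕ) (_ : StrictMono φ) =>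
      (∑' j, ‖a (φ j)‖ₑ ^ p * ENNReal.ofReal (w j)) ^ (1 / p)) φ hφ

namespace GarlingSpace

/-- The element of the space with the given entries. -/
def ofSeq (hp : 0 < p) (a : ℕ → 𝕜)
    (ha : spreadNorm (fun j => ENNReal.ofReal (w j)) (fun i => ‖a i‖ₑ ^ p) ≠ ∞) :
    GarlingSpace 𝕜 w p hp :=
  (⟨a, by
    change garlingENorm w p a < ∞
    rw [garlingENorm_eq_spreadNorm hp]
    exact ENNReal.rpow_lt_top_of_nonneg (by positivity) ha⟩ : garlingSubmodule 𝕜 w p hp)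

/-- The entries, as linear functionals. -/
def coordₗ (hp : 0 < p) (i : ℕ) : GarlingSpace 𝕜 w p hp →ₗ[𝕜] 𝕜 where
  toFun x := x.toSeq i
  map_add' _ _ := rfl
  map_smul' _ _ := rfl

variable {hp : 0 < p}

/-- The `p`-th power of the quasi-norm. -/
def powNorm (x : GarlingSpace 𝕜 w p hp) : ℝ≥0∞ :=
  spreadNorm (fun j => ENNReal.ofReal (w j)) (fun i => ‖x.toSeq i‖ₑ ^ p)

theorem powNorm_ne_top (x : GarlingSpace 𝕜 w p hp) : x.powNorm ≠ ∞ := fun h => by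
  refine x.garlingENorm_toSeq_ne_top ?_
  rw [garlingENorm_eq_spreadNorm hp]
  exact (congrArg (· ^ (1 / p)) h).trans (ENNReal.top_rpow_of_pos (by positivity))

@[simp]
theorem toSeq_ofSeq (a : ℕ → 𝕜)
    (ha : spreadNorm (fun j => ENNReal.ofReal (w j)) (fun i => ‖a i‖ₑ ^ p) ≠ ∞) :
    (ofSeq hp a ha).toSeq = a := rfl

theorem ext_toSeq {x y : GarlingSpace 𝕜 w p hp} (h : ∀ i, x.toSeq i = y.toSeq i) : x = y :=
  Subtype.ext (funext h)

theorem toSeq_sub (x y : GarlingSpace 𝕜 w p hp) (i : ℕ) :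
    (x - y).toSeq i = x.toSeq i - y.toSeq i := rfl

theorem toSeq_add (x y : GarlingSpace 𝕜 w p hp) (i : ℕ) :
    (x + y).toSeq i = x.toSeq i + y.toSeq i := rfl

theorem toSeq_smul (c : 𝕜) (x : GarlingSpace 𝕜 w p hp) (i : ℕ) :
    (c • x).toSeq i = c * x.toSeq i := rfl

theorem toSeq_sum_smul (F : Finset ℕ) (a : ℕ → 𝕜) (x : ℕ → GarlingSpace 𝕜 w p hp) (i : ℕ) :
    (∑ j ∈ F, a j • x j).toSeq i = ∑ j ∈ F, a j * (x j).toSeq i := by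
  have h := map_sum (coordₗ (w := w) hp i) (fun j => a j • x j) F
  exact h

theorem powNorm_mono {x y : GarlingSpace 𝕜 w p hp} (h : ∀ i, ‖x.toSeq i‖ ≤ ‖y.toSeq i‖) :
    x.powNorm ≤ y.powNorm :=
  spreadNorm_mono fun i => ENNReal.rpow_le_rpow (enorm_le_iff_norm_le.2 (h i)) hp.le

theorem norm_lt_iff (x : GarlingSpace 𝕜 w p hp) (ε : ℝ) :
    ‖x‖ < ε ↔ x.powNorm < ENNReal.ofReal ε ^ p := by
  rw [norm_def, ← ENNReal.lt_ofReal_iff_toReal_lt x.garlingENorm_toSeq_ne_top,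
    garlingENorm_eq_spreadNorm hp, one_div, ENNReal.rpow_inv_lt_iff hp, powNorm]

theorem hasBasis_nhds (x : GarlingSpace 𝕜 w p hp) :
    (𝓝 x).HasBasis (fun δ : ℝ≥0∞ => δ ≠ 0) (fun δ => {y | (y - x).powNorm < δ}) := by
  refine ⟨fun U => ?_⟩
  rw [((ballBasis (𝕜 := 𝕜) (w := w) hp).toAddGroupFilterBasis.nhds_hasBasis x).mem_iff]
  constructor
  · rintro ⟨_, ⟨ε, hε, rfl⟩, hU⟩
    refine ⟨ENNReal.ofReal ε ^ p, (ENNReal.rpow_pos (ENNReal.ofReal_pos.2 hε)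
      ENNReal.ofReal_ne_top).ne', fun y hy => hU ⟨y - x, (norm_lt_iff _ _).2 hy, by simp⟩⟩
  · rintro ⟨δ, hδ, hU⟩
    -- The cap at 1 keeps the radius finite when `δ = ∞`.
    have hm0 : min δ 1 ≠ 0 := (lt_min (pos_iff_ne_zero.2 hδ) one_pos).ne'
    have hmt : min δ 1 ≠ ∞ := ((min_le_right _ _).trans_lt ENNReal.one_lt_top).ne
    have ht : (min δ 1) ^ (1 / p) ≠ ∞ := (ENNReal.rpow_lt_top_of_nonneg (by positivity) hmt).ne
    refine ⟨_, ⟨((min δ 1) ^ (1 / p)).toReal, ENNReal.toReal_pos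
      (ENNReal.rpow_pos (pos_iff_ne_zero.2 hm0) hmt).ne' ht, rfl⟩, ?_⟩
    rintro _ ⟨y, hy, rfl⟩
    have h := (norm_lt_iff _ _).1 hy
    rw [ENNReal.ofReal_toReal ht, ← ENNReal.rpow_mul, one_div_mul_cancel hp.ne',
      ENNReal.rpow_one] at h
    exact hU (by simpa using h.trans_le (min_le_left _ _))

theorem tendsto_iff {α : Type*} {l : Filter α} {f : α → GarlingSpace 𝕜 w p hp}
    {x : GarlingSpace 𝕜 w p hp} :
    Tendsto f l (𝓝 x) ↔ ∀ δ : ℝ≥0∞, δ ≠ 0 → ∀ᶠ n in l, (f n - x).powNorm < δ :=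
  (hasBasis_nhds x).tendsto_right_iff

theorem enorm_toSeq_rpow_le (hw0 : w 0 = 1) (x : GarlingSpace 𝕜 w p hp) (i : ℕ) :
    ‖x.toSeq i‖ₑ ^ p ≤ x.powNorm :=
  le_spreadNorm (by simp [hw0]) (fun i => ‖x.toSeq i‖ₑ ^ p) i

theorem continuous_toSeq (hw0 : w 0 = 1) (i : ℕ) :
    Continuous fun x : GarlingSpace 𝕜 w p hp => x.toSeq i := by
  rw [continuous_iff_continuousAt]
  intro x
  rw [ContinuousAt, Metric.tendsto_nhds]
  intro ε hε
  filter_upwards [(tendsto_iff.1 tendsto_id) (ENNReal.ofReal ε ^ p) (ENNReal.rpow_pos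
    (ENNReal.ofReal_pos.2 hε) ENNReal.ofReal_ne_top).ne'] with y hy
  have h := (enorm_toSeq_rpow_le hw0 (y - x) i).trans_lt hy
  rw [ENNReal.rpow_lt_rpow_iff hp, toSeq_sub, ← ofReal_norm, ENNReal.ofReal_lt_ofReal_iff hε] at h
  rwa [dist_eq_norm]

/-! ### Sequences with disjoint supports -/

/-- The sequence consists of nonzero vectors with disjoint supports. -/
def IsDisjointSeq (x : ℕ → GarlingSpace 𝕜 w p hp) : Prop :=
  (∀ n, ∃ i, (x n).toSeq i ≠ 0) ∧
    ∀ i m n, (x m).toSeq i ≠ 0 → (x n).toSeq i ≠ 0 → m = n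

variable {x : ℕ → GarlingSpace 𝕜 w p hp}

theorem IsDisjointSeq.comp (hx : IsDisjointSeq x) {φ : ℕ → ℕ} (hφ : Function.Injective φ) :
    IsDisjointSeq (x ∘ φ) :=
  ⟨fun n => hx.1 (φ n), fun i _ _ hm hn => hφ (hx.2 i _ _ hm hn)⟩

theorem IsDisjointSeq.eq_zero (hx : IsDisjointSeq x) {i j k : ℕ} (hj : (x j).toSeq i ≠ 0)
    (hk : k ≠ j) : (x k).toSeq i = 0 := by
  by_contra h
  exact hk (hx.2 i k j h hj)

theorem IsDisjointSeq.sum_mem (hx : IsDisjointSeq x) {F : Finset ℕ} (a : ℕ → 𝕜) {i j : ℕ}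
    (hj : (x j).toSeq i ≠ 0) (hF : j ∈ F) :
    (∑ j ∈ F, a j • x j).toSeq i = a j * (x j).toSeq i := by
  rw [toSeq_sum_smul]
  exact Finset.sum_eq_single_of_mem j hF fun k _ hk => by rw [hx.eq_zero hj hk, mul_zero]

theorem sum_eq_zero_of_forall {F : Finset ℕ} (a : ℕ → 𝕜) {i : ℕ}
    (h : ∀ j ∈ F, (x j).toSeq i = 0) : (∑ j ∈ F, a j • x j).toSeq i = 0 := by
  rw [toSeq_sum_smul]
  exact Finset.sum_eq_zero fun k hk => by rw [h k hk, mul_zero]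

theorem IsDisjointSeq.toSeq_of_tendsto (hw0 : w 0 = 1) (hx : IsDisjointSeq x) {a : ℕ → 𝕜}
    {v : GarlingSpace 𝕜 w p hp} (hv : SeriesTendsto a x v) {i j : ℕ} (hj : (x j).toSeq i ≠ 0) :
    v.toSeq i = a j * (x j).toSeq i := by
  have h1 := ((continuous_toSeq hw0 i).tendsto v).comp hv
  refine tendsto_nhds_unique h1 (tendsto_const_nhds.congr' ?_)
  filter_upwards [eventually_gt_atTop j] with n hn
  exact (hx.sum_mem a hj (Finset.mem_range.2 hn)).symm

/-- On the support of `x j` every vector of the closed span is proportional to `x j`.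
Cross-multiplied, this is a closed linear condition that the generators satisfy. -/
theorem IsDisjointSeq.mul_eq_mul (hw0 : w 0 = 1) (hx : IsDisjointSeq x)
    {v : GarlingSpace 𝕜 w p hp} (hv : v ∈ closedSpan 𝕜 x) {i i' j : ℕ} (hi : (x j).toSeq i ≠ 0)
    (hi' : (x j).toSeq i' ≠ 0) : v.toSeq i * (x j).toSeq i' = v.toSeq i' * (x j).toSeq i := by
  have hclosed : IsClosed {v : GarlingSpace 𝕜 w p hp |
      v.toSeq i * (x j).toSeq i' = v.toSeq i' * (x j).toSeq i} :=
    isClosed_eq ((continuous_toSeq hw0 i).mul_const _) ((continuous_toSeq hw0 i').mul_const _)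
  refine closure_minimal (fun f hf => ?_) hclosed hv
  induction hf using Submodule.span_induction with
  | mem f hf =>
    obtain ⟨k, rfl⟩ := hf
    by_cases hk : k = j
    · subst hk
      exact mul_comm _ _
    · simp [hx.eq_zero hi hk, hx.eq_zero hi' hk]
  | zero => simp [show ∀ i, (0 : GarlingSpace 𝕜 w p hp).toSeq i = 0 from fun _ => rfl]
  | add f g _ _ hf hg =>
    simp only [Set.mem_ofPred_eq, toSeq_add, add_mul] at hf hg ⊢
    rw [hf, hg]
  | smul c f _ hf =>
    simp only [Set.mem_ofPred_eq, toSeq_smul, mul_assoc] at hf ⊢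
    rw [hf]

theorem exists_vanish_of_mem_span {f : GarlingSpace 𝕜 w p hp}
    (hf : f ∈ Submodule.span 𝕜 (Set.range x)) :
    ∃ n, ∀ i, (∀ j < n, (x j).toSeq i = 0) → f.toSeq i = 0 := by
  induction hf using Submodule.span_induction with
  | mem f hf =>
    obtain ⟨k, rfl⟩ := hf
    exact ⟨k + 1, fun i hi => hi k (Nat.lt_succ_self k)⟩
  | zero => exact ⟨0, fun _ _ => rfl⟩
  | add f g _ _ hf hg =>
    obtain ⟨m, hm⟩ := hf
    obtain ⟨n, hn⟩ := hg
    refine ⟨max m n, fun i hi => ?_⟩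
    rw [toSeq_add, hm i fun j hj => hi j (hj.trans_le (le_max_left _ _)),
      hn i fun j hj => hi j (hj.trans_le (le_max_right _ _)), add_zero]
  | smul c f _ hf =>
    obtain ⟨m, hm⟩ := hf
    exact ⟨m, fun i hi => by rw [toSeq_smul, hm i hi, mul_zero]⟩

/-- Coefficients are read off at one place of each support. A partial sum equals `v` on the supports
of its terms and vanishes elsewhere, so entrywise it is no farther from `v` than any combination of
the same terms. -/
theorem IsDisjointSeq.isBasicSequence (hw0 : w 0 = 1) (hx : IsDisjointSeq x) :
    IsBasicSequence 𝕜 x := by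
  intro v hv
  choose pos hpos using hx.1
  refine ⟨fun j => v.toSeq (pos j) / (x j).toSeq (pos j), ?_, fun a ha => funext fun j => ?_⟩
  · refine tendsto_iff.2 fun δ hδ => ?_
    obtain ⟨f, hf, hfs⟩ := (mem_closure_iff_nhds_basis (hasBasis_nhds v)).1 hv δ hδ
    obtain ⟨n₀, hn₀⟩ := exists_vanish_of_mem_span hf
    filter_upwards [eventually_ge_atTop n₀] with n hn
    refine lt_of_le_of_lt (powNorm_mono fun i => ?_) hfs
    rw [toSeq_sub, toSeq_sub]
    by_cases hi : ∃ j < n, (x j).toSeq i ≠ 0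
    · obtain ⟨j, hj, hji⟩ := hi
      rw [hx.sum_mem _ hji (Finset.mem_range.2 hj), div_mul_eq_mul_div,
        ← hx.mul_eq_mul hw0 hv hji (hpos j), mul_div_cancel_right₀ _ (hpos j), sub_self, norm_zero]
      exact norm_nonneg _
    · push Not at hi
      rw [sum_eq_zero_of_forall _ fun j hj => hi j (Finset.mem_range.1 hj),
        hn₀ i fun j hj => hi j (hj.trans_le hn)]
  · rw [hx.toSeq_of_tendsto hw0 ha (hpos j), mul_div_cancel_right₀ _ (hpos j)]

theorem IsDisjointSeq.isUnconditional (hw0 : w 0 = 1) (hx : IsDisjointSeq x) :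
    IsUnconditionalBasicSequence 𝕜 x :=
  ⟨hx.isBasicSequence hw0, fun π => (hx.comp π.injective).isBasicSequence hw0⟩

/-- Cauchy's criterion for sequences with disjoint supports. -/
theorem IsDisjointSeq.exists_seriesTendsto_iff (hw0 : w 0 = 1) (hx : IsDisjointSeq x)
    (a : ℕ → 𝕜) :
    (∃ v, SeriesTendsto a x v) ↔ ∀ δ : ℝ≥0∞, δ ≠ 0 →
      ∃ k, ∀ l, (∑ j ∈ Finset.Ico k l, a j • x j).powNorm ≤ δ := by
  constructor
  · rintro ⟨v, hv⟩ δ hδ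
    obtain ⟨k, hk⟩ := (tendsto_iff.1 hv δ hδ).exists
    refine ⟨k, fun l => le_trans (powNorm_mono fun i => ?_) hk.le⟩
    by_cases hi : ∃ j ∈ Finset.Ico k l, (x j).toSeq i ≠ 0
    · obtain ⟨j, hj, hji⟩ := hi
      rw [hx.sum_mem a hji hj, toSeq_sub, hx.toSeq_of_tendsto hw0 hv hji,
        sum_eq_zero_of_forall, zero_sub, norm_neg]
      intro m hm
      refine hx.eq_zero hji ?_
      have := Finset.mem_range.1 hm
      have := (Finset.mem_Ico.1 hj).1
      omega
    · push Not at hi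
      rw [sum_eq_zero_of_forall a hi, norm_zero]
      exact norm_nonneg _
  · intro h
    -- The entrywise limit; at each place at most one term is nonzero.
    let y : ℕ → 𝕜 := fun i => ∑ᶠ j, a j * (x j).toSeq i
    have hy : ∀ i j, (x j).toSeq i ≠ 0 → y i = a j * (x j).toSeq i := fun i j hj =>
      finsum_eq_single _ j fun k hk => by rw [hx.eq_zero hj hk, mul_zero]
    have hy0 : ∀ i, (∀ j, (x j).toSeq i = 0) → y i = 0 := fun i hi => by
      simp [y, hi]
    let S : ℕ → GarlingSpace 𝕜 w p hp := fun k => ∑ j ∈ Finset.range k, a j • x j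
    have htail : ∀ (k : ℕ) (i : ℕ), (∀ j < k, (x j).toSeq i = 0) → y i - (S k).toSeq i = y i :=
      fun k i hi => by
        rw [sum_eq_zero_of_forall a fun j hj => hi j (Finset.mem_range.1 hj), sub_zero]
    have hhead : ∀ (k : ℕ) (i j : ℕ), j < k → (x j).toSeq i ≠ 0 → y i - (S k).toSeq i = 0 :=
      fun k i j hjk hj => by
        rw [hx.sum_mem a hj (Finset.mem_range.2 hjk), hy i j hj, sub_self]
    have key : ∀ δ : ℝ≥0∞, ∀ k, (∀ l, (∑ j ∈ Finset.Ico k l, a j • x j).powNorm ≤ δ) →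
        ∀ n ≥ k, spreadNorm (fun j => ENNReal.ofReal (w j))
          (fun i => ‖y i - (S n).toSeq i‖ₑ ^ p) ≤ δ := by
      intro δ k hk n hn
      have hl : ∀ i, ∃ l, ∀ j, (x j).toSeq i ≠ 0 → j < l := fun i => by
        by_cases hi : ∃ j, (x j).toSeq i ≠ 0
        · obtain ⟨j, hj⟩ := hi
          exact ⟨j + 1, fun m hm => by rw [hx.2 i m j hm hj]; exact Nat.lt_succ_self j⟩
        · push Not at hi
          exact ⟨0, fun j hj => absurd (hi j) hj⟩
      choose l hl using hl
      -- On finitely many places the remainder of `y` is bounded by one finite sum, to which the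
      -- hypothesis applies.
      refine spreadNorm_le_of_finset fun s =>
        ⟨_, fun i hi => ?_, hk (s.sup l)⟩
      refine ENNReal.rpow_le_rpow (enorm_le_iff_norm_le.2 ?_) hp.le
      by_cases hi' : ∃ j, (x j).toSeq i ≠ 0
      · obtain ⟨j, hj⟩ := hi'
        rcases lt_or_ge j n with hjn | hjn
        · rw [hhead n i j hjn hj, norm_zero]
          exact norm_nonneg _
        · rw [htail n i fun m hm => hx.eq_zero hj (by omega), hy i j hj, hx.sum_mem a hj]
          exact Finset.mem_Ico.2 ⟨hn.trans hjn, (hl i j hj).trans_le (Finset.le_sup hi)⟩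
      · push Not at hi'
        rw [htail n i fun m _ => hi' m, hy0 i hi', norm_zero]
        exact norm_nonneg _
    obtain ⟨k₁, hk₁⟩ := h 1 one_ne_zero
    -- Only the remainder of `y` is known to have finite norm, so the limit is assembled as
    -- remainder plus partial sum.
    let z : GarlingSpace 𝕜 w p hp := ofSeq hp (fun i => y i - (S k₁).toSeq i)
      ((key 1 k₁ hk₁ k₁ le_rfl).trans_lt ENNReal.one_lt_top).ne
    refine ⟨z + S k₁, tendsto_iff.2 fun δ hδ => ?_⟩
    obtain ⟨δ', hδ'0, hδ'⟩ := exists_between (pos_iff_ne_zero.2 hδ)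
    obtain ⟨k, hk⟩ := h δ' hδ'0.ne'
    filter_upwards [eventually_ge_atTop k] with n hn
    refine lt_of_le_of_lt ?_ hδ'
    refine le_trans (spreadNorm_mono fun i => ?_) (key δ' k hk n hn)
    rw [toSeq_sub, toSeq_add, toSeq_ofSeq, sub_add_cancel, ← enorm_neg, neg_sub]

end GarlingSpace

end GarlingBasic

end

/-! ### Block bases generated by one sequence -/

noncomputable section

section BlockSequences

variable {𝕜 : Type*} [RCLike 𝕜] {w : ℕ → ℝ} {p : ℝ}

theorem garlingWeights.antitone_ofReal (hw : w ∈ garlingWeights) :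
    Antitone fun j => ENNReal.ofReal (w j) :=
  fun _ _ h => ENNReal.ofReal_le_ofReal (hw.2.1 h)

theorem garlingWeights.tsum_ofReal (hw : w ∈ garlingWeights) :
    ∑' j, ENNReal.ofReal (w j) = ∞ := by
  by_contra h
  refine hw.2.2.2.2 ((ENNReal.summable_toReal h).congr fun j => ?_)
  exact ENNReal.toReal_ofReal (hw.2.2.1 j).le

theorem garlingWeights.tendsto_ofReal (hw : w ∈ garlingWeights) :
    Tendsto (fun j => ENNReal.ofReal (w j)) atTop (𝓝 0) := by
  simpa using ENNReal.tendsto_ofReal hw.2.2.2.1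

/-- The scalar whose `p`-th power has the given modulus. -/
def scalarRoot (𝕜 : Type*) [RCLike 𝕜] (p : ℝ) (c : ℝ≥0∞) : 𝕜 := ((c ^ (1 / p)).toReal : 𝕜)

theorem enorm_scalarRoot_rpow (hp : 0 < p) {c : ℝ≥0∞} (hc : c ≠ ∞) :
    ‖scalarRoot 𝕜 p c‖ₑ ^ p = c := by
  rw [scalarRoot, ← ofReal_norm, RCLike.norm_ofReal, abs_of_nonneg ENNReal.toReal_nonneg,
    ENNReal.ofReal_toReal (ENNReal.rpow_lt_top_of_nonneg (by positivity) hc).ne,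
    ← ENNReal.rpow_mul, one_div_mul_cancel hp.ne', ENNReal.rpow_one]

/-- The left end of the `n`-th of consecutive intervals of lengths `B 0, B 1, …`. -/
def blockStart (B : ℕ → ℕ) (n : ℕ) : ℕ := ∑ k ∈ Finset.range n, B k

theorem blockStart_add_le (B : ℕ → ℕ) {m n : ℕ} (h : m < n) :
    blockStart B m + B m ≤ blockStart B n := by
  rw [blockStart, ← Finset.sum_range_succ]
  exact Finset.sum_le_sum_of_subset (Finset.range_mono h)

theorem lt_of_blockStart_add_lt {B : ℕ → ℕ} {m n t t' : ℕ} (ht' : t' < B n)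
    (h : blockStart B m + t < blockStart B n + t') : m < n ∨ m = n ∧ t < t' := by
  rcases lt_trichotomy m n with h1 | rfl | h1
  · exact Or.inl h1
  · exact Or.inr ⟨rfl, by omega⟩
  · have := blockStart_add_le B h1
    omega

theorem blockStart_add_lt {B : ℕ → ℕ} {m n t t' : ℕ} (ht : t < B m)
    (h : m < n ∨ m = n ∧ t < t') : blockStart B m + t < blockStart B n + t' := by
  rcases h with h | ⟨rfl, h⟩
  · have := blockStart_add_le B h
    omega
  · omega

/-- The beginning of the sequence `d`, moved to the `n`-th interval. -/
def blockFun (𝕜 : Type*) [RCLike 𝕜] (p : ℝ) (B : ℕ → ℕ) (d : ℕ → ℝ≥0∞) (n i : ℕ) : 𝕜 :=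
  if blockStart B n ≤ i ∧ i < blockStart B n + B n then scalarRoot 𝕜 p (d (i - blockStart B n))
  else 0

theorem blockFun_add (B : ℕ → ℕ) (d : ℕ → ℝ≥0∞) {n t : ℕ} (ht : t < B n) :
    blockFun 𝕜 p B d n (blockStart B n + t) = scalarRoot 𝕜 p (d t) := by
  rw [blockFun, if_pos ⟨Nat.le_add_right _ _, by omega⟩, Nat.add_sub_cancel_left]

theorem exists_of_blockFun_ne_zero {B : ℕ → ℕ} {d : ℕ → ℝ≥0∞} {n i : ℕ}
    (h : blockFun 𝕜 p B d n i ≠ 0) : ∃ t < B n, i = blockStart B n + t := by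
  have h' : blockStart B n ≤ i ∧ i < blockStart B n + B n := by
    by_contra hn
    exact h (if_neg hn)
  exact ⟨i - blockStart B n, by omega, by omega⟩

theorem ne_top_of_spreadNorm_ne_top (hw : w ∈ garlingWeights) {d : ℕ → ℝ≥0∞}
    (hd : spreadNorm (fun j => ENNReal.ofReal (w j)) d ≠ ∞) (t : ℕ) : d t ≠ ∞ :=
  ((le_spreadNorm (by simp [hw.1]) d t).trans_lt hd.lt_top).ne

theorem spreadNorm_blockFun_ne_top (hp : 0 < p) (hw : w ∈ garlingWeights) (B : ℕ → ℕ)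
    {d : ℕ → ℝ≥0∞} (hd : spreadNorm (fun j => ENNReal.ofReal (w j)) d ≠ ∞) (n : ℕ) :
    spreadNorm (fun j => ENNReal.ofReal (w j)) (fun i => ‖blockFun 𝕜 p B d n i‖ₑ ^ p) ≠ ∞ := by
  refine (lt_of_le_of_lt ?_ hd.lt_top).ne
  refine spreadNorm_le_of_rel (garlingWeights.antitone_ofReal hw)
    (fun i t => i = blockStart B n + t) (fun i hi => ?_) (by intros; omega)
  have hne : blockFun 𝕜 p B d n i ≠ 0 := fun h => hi (by simp [h, hp])
  obtain ⟨t, ht, rfl⟩ := exists_of_blockFun_ne_zero hne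
  refine ⟨t, rfl, ?_⟩
  rw [blockFun_add B d ht, enorm_scalarRoot_rpow hp (ne_top_of_spreadNorm_ne_top hw hd t)]

/-- The block basis of the unit vector basis that is generated by the sequence `d`. -/
def blockVec (hp : 0 < p) (hw : w ∈ garlingWeights) (B : ℕ → ℕ)
    {d : ℕ → ℝ≥0∞} (hd : spreadNorm (fun j => ENNReal.ofReal (w j)) d ≠ ∞) (n : ℕ) :
    GarlingSpace 𝕜 w p hp :=
  GarlingSpace.ofSeq hp (blockFun 𝕜 p B d n) (spreadNorm_blockFun_ne_top hp hw B hd n)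

/-- The `p`-th powers of the moduli of the scalars with index in `F`. -/
def powSeq (p : ℝ) (a : ℕ → 𝕜) (F : Finset ℕ) (n : ℕ) : ℝ≥0∞ := if n ∈ F then ‖a n‖ₑ ^ p else 0

section BlockVec

variable {hp : 0 < p} (hw : w ∈ garlingWeights) {B : ℕ → ℕ} {d : ℕ → ℝ≥0∞}
  (hd : spreadNorm (fun j => ENNReal.ofReal (w j)) d ≠ ∞) (hd0 : d 0 = 1) (hB : ∀ n, 0 < B n)

theorem scalarRoot_one : scalarRoot 𝕜 p 1 = 1 := by
  simp [scalarRoot]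

include hd0 hB in
theorem isDisjointSeq_blockVec :
    GarlingSpace.IsDisjointSeq (blockVec (𝕜 := 𝕜) hp hw B hd) := by
  refine ⟨fun n => ⟨blockStart B n + 0, ?_⟩, fun i m n hm hn => ?_⟩
  · change blockFun 𝕜 p B d n (blockStart B n + 0) ≠ 0
    rw [blockFun_add B d (hB n), hd0, scalarRoot_one]
    exact one_ne_zero
  · obtain ⟨t, ht, h⟩ := exists_of_blockFun_ne_zero hm
    obtain ⟨t', ht', h'⟩ := exists_of_blockFun_ne_zero hn
    rcases lt_trichotomy m n with h1 | h1 | h1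
    · have := blockStart_add_le B h1
      omega
    · exact h1
    · have := blockStart_add_le B h1
      omega

variable {φ : ℕ → ℕ} (hφ : StrictMono φ) (a : ℕ → 𝕜) (F : Finset ℕ)

include hφ in
theorem enorm_sum_blockVec {n t : ℕ} (hn : n ∈ F) (ht : t < B (φ n)) :
    ‖(∑ j ∈ F, a j • blockVec (𝕜 := 𝕜) hp hw B hd (φ j)).toSeq (blockStart B (φ n) + t)‖ₑ ^ p
      = powSeq p a F n * d t := by
  have hdt := ne_top_of_spreadNorm_ne_top hw hd t
  have h : (∑ j ∈ F, a j • blockVec (𝕜 := 𝕜) hp hw B hd (φ j)).toSeq (blockStart B (φ n) + t) =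
      a n * scalarRoot 𝕜 p (d t) := by
    rw [GarlingSpace.toSeq_sum_smul, ← blockFun_add B d ht]
    refine Finset.sum_eq_single_of_mem n hn fun k _ hk => ?_
    by_cases h0 : (blockVec (𝕜 := 𝕜) hp hw B hd (φ k)).toSeq (blockStart B (φ n) + t) = 0
    · rw [h0, mul_zero]
    · obtain ⟨t', ht', h⟩ := exists_of_blockFun_ne_zero h0
      exfalso
      rcases lt_or_gt_of_ne hk with h1 | h1
      · have := blockStart_add_le B (hφ h1)
        omega
      · have := blockStart_add_le B (hφ h1)
        omega
  rw [h, enorm_mul, ENNReal.mul_rpow_of_nonneg _ _ hp.le, enorm_scalarRoot_rpow hp hdt, powSeq,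
    if_pos hn]

include hφ in
-- The intervals follow one another in the lexicographic order of the pairs (block, place), and
-- truncation only deletes entries.
theorem powNorm_sum_blockVec_le :
    (∑ j ∈ F, a j • blockVec (𝕜 := 𝕜) hp hw B hd (φ j)).powNorm ≤
      tensorNorm (fun j => ENNReal.ofReal (w j)) d (powSeq p a F) := by
  refine spreadNorm_le_of_rel (garlingWeights.antitone_ofReal hw) (fun i x =>
    (ofLex x).2 < B (φ (ofLex x).1) ∧ i = blockStart B (φ (ofLex x).1) + (ofLex x).2) ?_ ?_
  · intro i hi
    have hne : ∃ j ∈ F, (blockVec (𝕜 := 𝕜) hp hw B hd (φ j)).toSeq i ≠ 0 := by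
      by_contra! h
      refine hi ?_
      rw [GarlingSpace.sum_eq_zero_of_forall a h]
      simp [hp]
    obtain ⟨j, hj, hji⟩ := hne
    obtain ⟨t, ht, rfl⟩ := exists_of_blockFun_ne_zero hji
    exact ⟨toLex (j, t), ⟨ht, rfl⟩, (enorm_sum_blockVec hw hd hφ a F hj ht).le⟩
  · rintro i i' x x' ⟨h1, rfl⟩ ⟨h2, rfl⟩ hlt
    rw [Prod.Lex.lt_iff]
    rcases lt_of_blockStart_add_lt h2 hlt with h | ⟨h, h'⟩
    · exact Or.inl (hφ.lt_iff_lt.1 h)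
    · exact Or.inr ⟨hφ.injective h, h'⟩

theorem tsum_two_inv_pow_succ : ∑' n, (2⁻¹ : ℝ≥0∞) ^ (n + 1) = 1 := by
  rw [ENNReal.tsum_geometric_add_one, ENNReal.one_sub_inv_two, inv_inv]
  exact ENNReal.inv_mul_cancel two_ne_zero ENNReal.ofNat_ne_top

variable (hτ : ∀ n, spreadNorm (fun j => ENNReal.ofReal (w j)) (fun t => if B n ≤ t then d t else 0)
  ≤ 2⁻¹ ^ (n + 1))

include hd0 hB hφ hτ in
-- The full copies exceed the truncated ones by tails of functional at most `2⁻¹ ^ (n + 1)`. As `d 0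
-- = 1`, every coefficient is bounded by the `powNorm` of the sum, so all the tails together cost at
-- most that `powNorm` once more.
theorem tensorNorm_le_powNorm_sum_blockVec :
    tensorNorm (fun j => ENNReal.ofReal (w j)) d (powSeq p a F) ≤
      2 * (∑ j ∈ F, a j • blockVec (𝕜 := 𝕜) hp hw B hd (φ j)).powNorm := by
  set M := (∑ j ∈ F, a j • blockVec (𝕜 := 𝕜) hp hw B hd (φ j)).powNorm with hM
  set b := powSeq p a F with hb
  have hv := garlingWeights.antitone_ofReal hw
  have hsplit : ∀ x : ℕ ×ₗ ℕ, b (ofLex x).1 * d (ofLex x).2 =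
      (if (ofLex x).2 < B (φ (ofLex x).1) then b (ofLex x).1 * d (ofLex x).2 else 0) +
        b (ofLex x).1 * (if B (φ (ofLex x).1) ≤ (ofLex x).2 then d (ofLex x).2 else 0) := fun x => by
    rcases lt_or_ge (ofLex x).2 (B (φ (ofLex x).1)) with h | h
    · simp [h, h.not_ge]
    · simp [h, h.not_gt]
  rw [tensorNorm, funext hsplit, two_mul]
  refine (spreadNorm_add_le _ _).trans (add_le_add ?_ ?_)
  · refine spreadNorm_le_of_rel hv (fun x i =>
      (ofLex x).2 < B (φ (ofLex x).1) ∧ i = blockStart B (φ (ofLex x).1) + (ofLex x).2) ?_ ?_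
    · intro x hx
      have h1 : (ofLex x).2 < B (φ (ofLex x).1) := by
        by_contra h
        exact hx (if_neg h)
      rw [if_pos h1] at hx
      have h2 : (ofLex x).1 ∈ F := by
        by_contra h
        exact hx (by simp [hb, powSeq, h])
      exact ⟨_, ⟨h1, rfl⟩, by
        rw [if_pos h1, enorm_sum_blockVec hw hd hφ a F h2 h1]⟩
    · rintro x x' i i' ⟨h1, rfl⟩ ⟨h2, rfl⟩ hlt
      rw [Prod.Lex.lt_iff] at hlt
      refine blockStart_add_lt h1 ?_
      rcases hlt with h | ⟨h, h'⟩
      · exact Or.inl (hφ h)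
      · exact Or.inr ⟨by rw [h], h'⟩
  · have hbM : ∀ n, b n ≤ M := fun n => by
      by_cases hn : n ∈ F
      · have h1 := enorm_sum_blockVec (hp := hp) hw hd hφ a F hn (hB (φ n))
        rw [hd0, mul_one] at h1
        rw [hb, ← h1]
        exact GarlingSpace.enorm_toSeq_rpow_le hw.1 _ _
      · simp [hb, powSeq, hn]
    refine (spreadNorm_lex_le_tsum hv
      fun n t => b n * (if B (φ n) ≤ t then d t else 0)).trans ?_
    calc _ ≤ ∑' n, M * 2⁻¹ ^ (n + 1) := by
          refine ENNReal.tsum_le_tsum fun n => ?_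
          rw [spreadNorm_const_mul]
          refine mul_le_mul' (hbM n) ((hτ (φ n)).trans ?_)
          exact pow_le_pow_right_of_le_one' (ENNReal.inv_le_one.2 one_le_two)
            (Nat.succ_le_succ (hφ.id_le n))
      _ = M := by rw [ENNReal.tsum_mul_left, tsum_two_inv_pow_succ, mul_one]

include hd0 hB hφ hτ in
-- The criterion does not mention `φ`, which is why all subsequences are equivalent.
theorem exists_seriesTendsto_blockVec_iff :
    (∃ v, SeriesTendsto a (blockVec (𝕜 := 𝕜) hp hw B hd ∘ φ) v) ↔ ∀ δ : ℝ≥0∞, δ ≠ 0 →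
      ∃ k, ∀ l, tensorNorm (fun j => ENNReal.ofReal (w j)) d (powSeq p a (Finset.Ico k l)) ≤ δ := by
  rw [((isDisjointSeq_blockVec (hp := hp) hw hd hd0 hB).comp
    hφ.injective).exists_seriesTendsto_iff hw.1]
  constructor
  · intro h δ hδ
    obtain ⟨k, hk⟩ := h (δ / 2) (ENNReal.half_pos hδ).ne'
    refine ⟨k, fun l => (tensorNorm_le_powNorm_sum_blockVec (hp := hp) hw hd hd0 hB hφ a _
      hτ).trans ?_⟩
    calc _ ≤ 2 * (δ / 2) := by gcongr; exact hk l
      _ = δ := ENNReal.mul_div_cancel two_ne_zero ENNReal.ofNat_ne_top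
  · intro h δ hδ
    obtain ⟨k, hk⟩ := h δ hδ
    exact ⟨k, fun l => (powNorm_sum_blockVec_le hw hd hφ a _).trans (hk l)⟩

include hd0 hB hτ in
theorem isSubsymmetric_blockVec : IsSubsymmetric 𝕜 (blockVec (𝕜 := 𝕜) hp hw B hd) := by
  refine ⟨(isDisjointSeq_blockVec hw hd hd0 hB).isUnconditional hw.1, fun φ hφ a => ?_⟩
  exact (exists_seriesTendsto_blockVec_iff hw hd hd0 hB hφ a hτ).trans
    (exists_seriesTendsto_blockVec_iff hw hd hd0 hB strictMono_id a hτ).symm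

end BlockVec

/-! ### Domination -/

section Domination

variable {hp : 0 < p}

theorem exists_seriesTendsto_of_dominates {x y : ℕ → GarlingSpace 𝕜 w p hp}
    (h : Dominates 𝕜 x y) {a : ℕ → 𝕜} (ha : ∃ v, SeriesTendsto a x v) :
    ∃ v, SeriesTendsto a y v := by
  obtain ⟨T, hT⟩ := h
  obtain ⟨v, hv⟩ := ha
  have hmem : ∀ n, ∑ j ∈ Finset.range n, a j • x j ∈ closedSpan 𝕜 x := fun n =>
    Submodule.sum_mem _ fun j _ => Submodule.smul_mem _ _ (mem_closedSpan 𝕜 x j)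
  have hvm : v ∈ closedSpan 𝕜 x :=
    (Submodule.isClosed_topologicalClosure _).mem_of_tendsto hv (Eventually.of_forall hmem)
  refine ⟨T ⟨v, hvm⟩, ?_⟩
  have h1 : Tendsto (fun n => (⟨_, hmem n⟩ : closedSpan 𝕜 x)) atTop (𝓝 ⟨v, hvm⟩) :=
    tendsto_subtype_rng.2 hv
  have h2 := (continuous_subtype_val.tendsto _).comp ((T.continuous.tendsto _).comp h1)
  refine h2.congr fun n => ?_
  have h3 : (⟨_, hmem n⟩ : closedSpan 𝕜 x) =
      ∑ j ∈ Finset.range n, a j • ⟨x j, mem_closedSpan 𝕜 x j⟩ := by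
    ext
    simp
  simp only [Function.comp_apply]
  rw [h3, map_sum]
  simp only [map_smul, hT]
  simp

/-- The multiplication by the indicator function of a set of places. -/
def maskCLM (hp : 0 < p) (E : Set ℕ) : GarlingSpace 𝕜 w p hp →L[𝕜] GarlingSpace 𝕜 w p hp :=
  have hE : ∀ x : GarlingSpace 𝕜 w p hp, ∀ i, ‖E.indicator x.toSeq i‖ ≤ ‖x.toSeq i‖ := fun x i =>
    norm_indicator_le_norm_self _ _
  let L : GarlingSpace 𝕜 w p hp →ₗ[𝕜] GarlingSpace 𝕜 w p hp :=
    { toFun := fun x => GarlingSpace.ofSeq hp (E.indicator x.toSeq)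
        ((spreadNorm_mono fun i => ENNReal.rpow_le_rpow (enorm_le_iff_norm_le.2 (hE x i))
          hp.le).trans_lt x.powNorm_ne_top.lt_top).ne
      map_add' := fun x y => GarlingSpace.ext_toSeq fun i =>
        congrFun (Set.indicator_add E x.toSeq y.toSeq) i
      map_smul' := fun c x => GarlingSpace.ext_toSeq fun i =>
        congrFun (Set.indicator_const_smul E c x.toSeq) i }
  { L with
    cont := continuous_iff_continuousAt.2 fun x => GarlingSpace.tendsto_iff.2 fun δ hδ => by
      filter_upwards [GarlingSpace.tendsto_iff.1 tendsto_id δ hδ] with y hy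
      refine lt_of_le_of_lt ?_ hy
      change (L y - L x).powNorm ≤ _
      rw [← map_sub]
      exact GarlingSpace.powNorm_mono (hE (y - x)) }

/-- The operator restricts to the union of the supports of the `y n`. Where `y m` is nonzero so is
`x m`, hence every other `x n` vanishes there. -/
theorem GarlingSpace.IsDisjointSeq.dominates {x y : ℕ → GarlingSpace 𝕜 w p hp}
    (hx : IsDisjointSeq x) (h : ∀ n i, (y n).toSeq i = 0 ∨ (y n).toSeq i = (x n).toSeq i) :
    Dominates 𝕜 x y := by
  classical
  set E : Set ℕ := {i | ∃ n, (y n).toSeq i ≠ 0}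
  set T := maskCLM (𝕜 := 𝕜) (w := w) hp E
  have hT : ∀ n, T (x n) = y n := fun n => ext_toSeq fun i => by
    change E.indicator (x n).toSeq i = _
    by_cases hi : i ∈ E
    · rw [Set.indicator_of_mem hi]
      obtain ⟨m, hm⟩ := hi
      by_cases hmn : n = m
      · subst hmn
        exact ((h n i).resolve_left hm).symm
      · have h0 : (x n).toSeq i = 0 :=
          hx.eq_zero (by rwa [(h m i).resolve_left hm] at hm) hmn
        rcases h n i with h1 | h1
        · rw [h0, h1]
        · rw [h1]
    · rw [Set.indicator_of_notMem hi]
      by_contra h0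
      exact hi ⟨n, fun h1 => h0 h1.symm⟩
  have hle : closedSpan 𝕜 x ≤ (closedSpan 𝕜 y).comap (T : _ →ₗ[𝕜] GarlingSpace 𝕜 w p hp) := by
    refine Submodule.topologicalClosure_minimal _ (Submodule.span_le.2 ?_)
      ((Submodule.isClosed_topologicalClosure _).preimage T.continuous)
    rintro _ ⟨n, rfl⟩
    change T (x n) ∈ closedSpan 𝕜 y
    rw [hT]
    exact mem_closedSpan 𝕜 y n
  exact ⟨(T.comp (closedSpan 𝕜 x).subtypeL).codRestrict _ fun v => hle v.2,
    fun n => Subtype.ext (hT n)⟩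

end Domination

end BlockSequences

end

/-! ### Families indexed by sets of natural numbers -/

noncomputable section

section Family

variable {𝕜 : Type*} [RCLike 𝕜] {w : ℕ → ℝ} {p : ℝ}

theorem maskSeq_ne_top {v : ℕ → ℝ≥0∞} {c : ℕ → ℝ≥0∞} (hc : spreadNorm v c ≠ ∞) (A : Set ℕ) :
    spreadNorm v (maskSeq A c) ≠ ∞ :=
  ((spreadNorm_mono (maskSeq_le A c)).trans_lt hc.lt_top).ne

theorem maskSeq_eq_zero_or {A B : Set ℕ} (h : A ⊆ B) (c : ℕ → ℝ≥0∞) (i : ℕ) :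
    maskSeq A c i = 0 ∨ maskSeq A c i = maskSeq B c i := by
  rw [maskSeq]
  split_ifs with hA
  · rw [maskSeq, if_pos fun m hm => h (hA m hm)]
    exact Or.inr rfl
  · exact Or.inl rfl

/-- The coefficients superpose the tests `b m`, `m ∈ A \ B`, on the places `⟨m, t⟩`. Against `B`
their values are summable, so the tails are small; against `A` each is at least 1/2, and infinitely
many lie beyond any `k`. -/
theorem exists_separating {c : ℕ → ℝ≥0∞} (hw : w ∈ garlingWeights) (hp : 0 < p)
    (b : ℕ → ℕ → ℝ≥0∞) (hfin : ∀ m, ∃ l, ∀ n ≥ l, b m n = 0) (htop : ∀ m n, b m n ≠ ∞)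
    (A B : Set ℕ) (hAB : (A \ B).Infinite)
    (hbig : ∀ m ∈ A, 1 ≤ 2 * tensorNorm (fun j => ENNReal.ofReal (w j)) (maskSeq A c) (b m))
    (hsmall : ∀ m ∉ B,
      tensorNorm (fun j => ENNReal.ofReal (w j)) (maskSeq B c) (b m) ≤ 3 * 2⁻¹ ^ (m + 1)) :
    ∃ a : ℕ → 𝕜,
      (∀ δ : ℝ≥0∞, δ ≠ 0 → ∃ k, ∀ l, tensorNorm (fun j => ENNReal.ofReal (w j)) (maskSeq B c)
        (powSeq p a (Finset.Ico k l)) ≤ δ) ∧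
      ¬ ∀ δ : ℝ≥0∞, δ ≠ 0 → ∃ k, ∀ l, tensorNorm (fun j => ENNReal.ofReal (w j)) (maskSeq A c)
        (powSeq p a (Finset.Ico k l)) ≤ δ := by
  classical
  have hv := garlingWeights.antitone_ofReal hw
  let g : ℕ → ℕ → ℝ≥0∞ := fun m t => if m ∈ A \ B then b m t else 0
  let f : ℕ → ℕ → ℝ≥0∞ := fun m i => if (Nat.unpair i).1 = m then g m (Nat.unpair i).2 else 0
  have hgtop : ∀ m t, g m t ≠ ∞ := fun m t => by
    simp only [g]
    split_ifs
    · exact htop m t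
    · exact ENNReal.zero_ne_top
  have hgfin : ∀ m, ∃ l, ∀ t ≥ l, g m t = 0 := fun m => by
    obtain ⟨l, hl⟩ := hfin m
    exact ⟨l, fun t ht => by simp [g, hl t ht]⟩
  choose l hl using hgfin
  let a : ℕ → 𝕜 := fun i => scalarRoot 𝕜 p (g (Nat.unpair i).1 (Nat.unpair i).2)
  have ha : ∀ i, ‖a i‖ₑ ^ p = g (Nat.unpair i).1 (Nat.unpair i).2 := fun i =>
    enorm_scalarRoot_rpow hp (hgtop _ _)
  refine ⟨a, fun δ hδ => ?_, fun h => ?_⟩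
  · have htail := exists_tail_le
      (Φ := tensorNorm (fun j => ENNReal.ofReal (w j)) (maskSeq B c))
      (fun _ _ h => tensorNorm_mono (fun _ => le_rfl) h) (tensorNorm_tsum_right_le _)
      (by simp [tensorNorm, spreadNorm_zero]) f (fun m => ⟨Nat.pair m (l m), fun i hi => ?_⟩) ?_ hδ
    · obtain ⟨k, hk⟩ := htail
      refine ⟨k, fun l => le_trans (tensorNorm_mono (fun _ => le_rfl) fun n => ?_) hk⟩
      rw [powSeq]
      split_ifs with h1 h2 h2
      · rw [ha]
        exact (tsum_place g n).ge
      · exact absurd (Finset.mem_Ico.1 h1).1 h2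
      · exact zero_le
      · exact le_rfl
    · by_cases him : (Nat.unpair i).1 = m
      · simp only [f, if_pos him]
        refine hl m _ ?_
        by_contra hlt
        exact absurd ((place_strictMono m i _ _ (l m) ⟨him, rfl⟩ (by simp)).2 (not_le.1 hlt))
          hi.not_gt
      · exact if_neg him
    · refine ((ENNReal.tsum_le_tsum (g := fun m => 3 * 2⁻¹ ^ (m + 1)) fun m => ?_).trans_lt ?_).ne
      · by_cases hm : m ∈ A \ B
        · refine le_trans ?_ (hsmall m hm.2)
          refine tensorNorm_le_of_rel hv Eq
            (fun i t => (Nat.unpair i).1 = m ∧ (Nat.unpair i).2 = t)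
            (fun t _ => ⟨t, rfl, le_rfl⟩) (by rintro i i' _ _ rfl rfl h; exact h) (fun i hi => ?_)
            (fun i i' k k' h h' hlt => (place_strictMono m i i' k k' h h').1 hlt)
            (by rintro i _ _ ⟨-, rfl⟩ ⟨-, rfl⟩; rfl)
          have him : (Nat.unpair i).1 = m := by
            by_contra h
            exact hi (if_neg h)
          exact ⟨_, ⟨him, rfl⟩, by simp [f, g, him, hm.1, hm.2]⟩
        · have h0 : f m = fun _ => 0 := by
            funext i
            simp only [f, g, if_neg hm, ite_self]
          rw [h0]
          simp [tensorNorm, spreadNorm_zero]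
      · rw [ENNReal.tsum_mul_left, tsum_two_inv_pow_succ, mul_one]
        exact ENNReal.ofNat_lt_top
  · obtain ⟨k, hk⟩ := h (2⁻¹ * 2⁻¹) (by simp)
    obtain ⟨m, hm, hkm⟩ := hAB.exists_gt k
    have h1 : tensorNorm (fun j => ENNReal.ofReal (w j)) (maskSeq A c) (b m) ≤ 2⁻¹ * 2⁻¹ := by
      refine le_trans ?_ (hk (Nat.pair m (l m)))
      refine tensorNorm_le_of_rel hv Eq
        (fun t i => (Nat.unpair i).1 = m ∧ (Nat.unpair i).2 = t)
        (fun t _ => ⟨t, rfl, le_rfl⟩) (by rintro i i' _ _ rfl rfl h; exact h) (fun t ht => ?_)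
        (fun i i' k k' h h' hlt => (place_strictMono m k k' i i' h h').2 hlt) ?_
      · have hg : g m t = b m t := if_pos hm
        have htl : t < l m := by
          by_contra hlt
          exact ht (hg ▸ hl m t (not_lt.1 hlt))
        refine ⟨Nat.pair m t, by simp, ?_⟩
        rw [powSeq, if_pos, ha, Nat.unpair_pair, hg]
        exact Finset.mem_Ico.2 ⟨hkm.le.trans (Nat.left_le_pair m t), Nat.pair_lt_pair_right m htl⟩
      · rintro t k k' ⟨h1, rfl⟩ ⟨h2, h3⟩
        rw [← Nat.pair_unpair k, ← Nat.pair_unpair k', h1, h2, h3]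
    have h2 : (1 : ℝ≥0∞) ≤ 2⁻¹ := by
      refine (hbig m hm.1).trans ((mul_le_mul_right h1 2).trans (le_of_eq ?_))
      rw [← mul_assoc, ENNReal.mul_inv_cancel two_ne_zero ENNReal.ofNat_ne_top, one_mul]
    exact absurd h2 (by simp)

/-- Subsymmetric basic sequences indexed by the sets of natural numbers, ordered by domination
in the way the sets are ordered by inclusion. -/
theorem exists_subsymmetric_family (hp : 0 < p) (hw : w ∈ garlingWeights) :
    ∃ X : Set ℕ → ℕ → GarlingSpace 𝕜 w p hp, (∀ A, IsSubsymmetric 𝕜 (X A)) ∧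
      (∀ A B, A ⊆ B → Dominates 𝕜 (X B) (X A)) ∧
      ∀ A B, (A \ B).Infinite → ∃ a : ℕ → 𝕜,
        (∃ v, SeriesTendsto a (X B) v) ∧ ¬ ∃ v, SeriesTendsto a (X A) v := by
  have hv := garlingWeights.antitone_ofReal hw
  obtain ⟨c, hc0, hc, htail, hsep⟩ := exists_profile hv (by simp [hw.1])
    (garlingWeights.tendsto_ofReal hw) (garlingWeights.tsum_ofReal hw)
  choose b hfin htop hb using hsep
  -- The lengths are chosen for `c` itself and serve all `A`, so that the blocks for different `A`
  -- lie on the same intervals.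
  have hB : ∀ n : ℕ, ∃ k, 0 < k ∧ spreadNorm (fun j => ENNReal.ofReal (w j))
      (fun i => if k ≤ i then c i else 0) ≤ 2⁻¹ ^ (n + 1) := fun n => by
    obtain ⟨k, hk⟩ := htail (2⁻¹ ^ (n + 1)) (pow_ne_zero _ (by simp))
    refine ⟨k + 1, k.succ_pos, (spreadNorm_mono fun i => ?_).trans hk⟩
    by_cases hi : k + 1 ≤ i
    · rw [if_pos hi, if_pos (by omega)]
    · rw [if_neg hi]
      exact zero_le
  choose B hB0 hB using hB
  -- Place 0 is `⟨0, 0⟩`, and piece 0 belongs to every mask.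
  have h0 : ∀ A : Set ℕ, maskSeq A c 0 = 1 := fun A => by
    rw [maskSeq, if_pos (by simp), hc0]
  have hτ : ∀ (A : Set ℕ) n, spreadNorm (fun j => ENNReal.ofReal (w j))
      (fun t => if B n ≤ t then maskSeq A c t else 0) ≤ 2⁻¹ ^ (n + 1) := fun A n => by
    refine (spreadNorm_mono fun i => ?_).trans (hB n)
    split_ifs
    · exact maskSeq_le A c i
    · exact le_rfl
  refine ⟨fun A => blockVec hp hw B (maskSeq_ne_top hc A),
    fun A => isSubsymmetric_blockVec hw _ (h0 A) hB0 (hτ A), fun A A' hA => ?_, fun A A' hA => ?_⟩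
  · refine (isDisjointSeq_blockVec hw _ (h0 A') hB0).dominates fun n i => ?_
    change blockFun 𝕜 p B (maskSeq A c) n i = 0 ∨
      blockFun 𝕜 p B (maskSeq A c) n i = blockFun 𝕜 p B (maskSeq A' c) n i
    by_cases hi : blockFun 𝕜 p B (maskSeq A c) n i = 0
    · exact Or.inl hi
    · right
      obtain ⟨t, ht, rfl⟩ := exists_of_blockFun_ne_zero hi
      rw [blockFun_add _ _ ht] at hi
      rw [blockFun_add _ _ ht, blockFun_add _ _ ht]
      rcases maskSeq_eq_zero_or hA c t with h | h
      · rw [h, scalarRoot, ENNReal.zero_rpow_of_pos (by positivity)] at hi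
        simp at hi
      · rw [h]
  · obtain ⟨a, h1, h2⟩ := exists_separating (𝕜 := 𝕜) (c := c) hw hp b hfin htop A A' hA
      (fun m hm => (hb m A).1 hm) (fun m hm => (hb m A').2 hm)
    exact ⟨a, (exists_seriesTendsto_blockVec_iff hw (maskSeq_ne_top hc A') (h0 A') hB0
      strictMono_id a (hτ A')).2 h1,
      fun h => h2
        ((exists_seriesTendsto_blockVec_iff hw (maskSeq_ne_top hc A) (h0 A) hB0
        strictMono_id a (hτ A)).1 h)⟩

/-- Separation needs infinite differences, and different real cuts of an enumerated `ℚ` have them.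
-/
theorem infinite_denumerable_between {r s : ℝ} (h : r < s) :
    {n : ℕ | r < (Denumerable.ofNat ℚ n : ℝ) ∧ (Denumerable.ofNat ℚ n : ℝ) < s}.Infinite := by
  have h1 : {q : ℚ | r < (q : ℝ) ∧ (q : ℝ) < s}.Infinite := by
    obtain ⟨q₁, hq₁, hq₁'⟩ := exists_rat_btwn h
    obtain ⟨q₂, hq₂, hq₂'⟩ := exists_rat_btwn hq₁'
    refine (Set.Ioo_infinite (Rat.cast_lt.1 hq₂)).mono fun q hq => ?_
    exact ⟨hq₁.trans (Rat.cast_lt.2 hq.1), (Rat.cast_lt.2 hq.2).trans hq₂'⟩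
  refine Set.Infinite.of_image (Denumerable.ofNat ℚ) (h1.mono fun q hq => ?_)
  have hq' := Denumerable.ofNat_encode q
  refine ⟨_, ?_, hq'⟩
  rw [Set.mem_ofPred_eq, hq']
  exact hq

theorem mk_range_eq_continuum {α : Type*} {f : ℝ → α} (hf : Function.Injective f) :
    Cardinal.mk (Set.range f) = Cardinal.continuum := by
  have h := Cardinal.mk_range_eq_of_injective hf
  rw [Cardinal.mk_real, Cardinal.lift_continuum] at h
  exact Cardinal.lift_injective (h.trans Cardinal.lift_continuum.symm)

end Family

end
theorem mainTheorem4 {𝕜 : Type*} [RCLike 𝕜] (p : ℝ) (hp : 0 < p) (w : ℕ → ℝ)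
    (hw : w ∈ garlingWeights) :
    (∃ S : Set (ℕ → GarlingSpace 𝕜 w p hp),
      Cardinal.mk S = Cardinal.continuum ∧
      (∀ x ∈ S, IsSubsymmetric 𝕜 x) ∧
      (∀ x ∈ S, ∀ y ∈ S, x ≠ y → ¬ EquivalentSequences 𝕜 x y) ∧
      (∀ x ∈ S, ∀ y ∈ S, Dominates 𝕜 x y ∨ Dominates 𝕜 y x)) ∧
    (∃ S : Set (ℕ → GarlingSpace 𝕜 w p hp),
      Cardinal.mk S = Cardinal.continuum ∧
      (∀ x ∈ S, IsSubsymmetric 𝕜 x) ∧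
      (∀ x ∈ S, ∀ y ∈ S, x ≠ y → ¬ Dominates 𝕜 x y ∧ ¬ Dominates 𝕜 y x)) := by
  obtain ⟨X, hsub, hdom, hsep⟩ := exists_subsymmetric_family (𝕜 := 𝕜) hp hw
  have hne : ∀ A B, (A \ B).Infinite → X A ≠ X B := fun A B h hX => by
    obtain ⟨a, h1, h2⟩ := hsep A B h
    rw [hX] at h2
    exact h2 h1
  have hnot : ∀ A B, (A \ B).Infinite → ¬ Dominates 𝕜 (X B) (X A) := fun A B h hd => by
    obtain ⟨a, h1, h2⟩ := hsep A B h
    exact h2 (exists_seriesTendsto_of_dominates hd h1)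
  have heq : ∀ A B, (A \ B).Infinite → ¬ EquivalentSequences 𝕜 (X A) (X B) := fun A B h he => by
    obtain ⟨a, h1, h2⟩ := hsep A B h
    exact h2 ((he a).2 h1)
  constructor
  · let C : ℝ → Set ℕ := fun r => {n | (Denumerable.ofNat ℚ n : ℝ) < r}
    have hC : ∀ r s, r < s → (C s \ C r).Infinite := fun r s h =>
      (infinite_denumerable_between h).mono fun n hn => ⟨hn.2, hn.1.not_gt⟩
    have hmono : ∀ r s, r ≤ s → C r ⊆ C s := fun r s h n hn => lt_of_lt_of_le hn h
    refine ⟨Set.range fun r => X (C r), mk_range_eq_continuum fun r s hrs => ?_, ?_, ?_, ?_⟩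
    · by_contra h
      rcases lt_or_gt_of_ne h with h | h
      · exact hne _ _ (hC _ _ h) hrs.symm
      · exact hne _ _ (hC _ _ h) hrs
    · rintro _ ⟨r, rfl⟩
      exact hsub _
    · rintro _ ⟨r, rfl⟩ _ ⟨s, rfl⟩ hrs
      rcases lt_or_gt_of_ne (fun h : r = s => hrs (by rw [h])) with h | h
      · exact fun he => heq _ _ (hC _ _ h) fun a => (he a).symm
      · exact heq _ _ (hC _ _ h)
    · rintro _ ⟨r, rfl⟩ _ ⟨s, rfl⟩
      rcases le_total r s with h | h
      · exact Or.inr (hdom _ _ (hmono _ _ h))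
      · exact Or.inl (hdom _ _ (hmono _ _ h))
  · let C : ℝ → Set ℕ := fun r => {n | (∃ m, n = 2 * m ∧ (Denumerable.ofNat ℚ m : ℝ) < r) ∨
      ∃ m, n = 2 * m + 1 ∧ r < (Denumerable.ofNat ℚ m : ℝ)}
    have hC : ∀ r s, r < s → (C s \ C r).Infinite := fun r s h => by
      refine ((infinite_denumerable_between h).image (f := fun m => 2 * m)
        (fun m _ n _ hmn => by simp only at hmn; omega)).mono ?_
      rintro _ ⟨m, hm, rfl⟩
      refine ⟨Or.inl ⟨m, rfl, hm.2⟩, ?_⟩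
      rintro (⟨k, hk, hk'⟩ | ⟨k, hk, -⟩)
      · obtain rfl : m = k := by simp only at hk; omega
        exact hm.1.not_gt hk'
      · simp only at hk
        omega
    have hC' : ∀ r s, r < s → (C r \ C s).Infinite := fun r s h => by
      refine ((infinite_denumerable_between h).image (f := fun m => 2 * m + 1)
        (fun m _ n _ hmn => by simp only at hmn; omega)).mono ?_
      rintro _ ⟨m, hm, rfl⟩
      refine ⟨Or.inr ⟨m, rfl, hm.1⟩, ?_⟩
      rintro (⟨k, hk, -⟩ | ⟨k, hk, hk'⟩)
      · simp only at hk
        omega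
      · obtain rfl : m = k := by simp only at hk; omega
        exact hm.2.not_gt hk'
    refine ⟨Set.range fun r => X (C r), mk_range_eq_continuum fun r s hrs => ?_, ?_, ?_⟩
    · by_contra h
      rcases lt_or_gt_of_ne h with h | h
      · exact hne _ _ (hC _ _ h) hrs.symm
      · exact hne _ _ (hC _ _ h) hrs
    · rintro _ ⟨r, rfl⟩
      exact hsub _
    · rintro _ ⟨r, rfl⟩ _ ⟨s, rfl⟩ hrs
      rcases lt_or_gt_of_ne (fun h : r = s => hrs (by rw [h])) with h | h
      · exact ⟨hnot _ _ (hC _ _ h), hnot _ _ (hC' _ _ h)⟩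
      · exact ⟨hnot _ _ (hC' _ _ h), hnot _ _ (hC _ _ h)⟩
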